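/- Let $\Omega\subset\mathbb R^n$ be bounded and open with $C^{3,a}$ boundary for some $a\in(0,1)$, and let $\mu$ be a measure on $\Omega$ whose density with respect to Lebesgue measure is continuous on $\Omega$ and bounded away from $0$ and $\infty$. Write $L^2=L^2(\Omega,\mu)$, with norm $\|\cdot\|$ and inner product $\langle\cdot,\cdot\rangle$, let $\mathcal H^2$ be the space of functions in $L^2$ whose weak derivatives of order at most $2$ lie in $L^2$, let $\mathcal H^1_0$ be the closure of $C_c^\infty(\Omega)$ in $\mathcal H^1$, and let $\mathcal H^2_{(0)}=\mathcal H^2\cap\mathcal H^1_0$ be the subspace of functions with zero boundary trace. Assume the following. (1) $\mathcal L:\mathcal H^2\to L^2$ is a (nonlinear) operator such that, for some constant $C$ and all $f_1,f_2\in\mathcal H^2$, for almost every $x\in\Omega$, $$|\mathcal Lf_1(x)-\mathcal Lf_2(x)|\le C\Big[|f_1(x)-f_2(x)|+\sum_i|\partial_if_1(x)-\partial_if_2(x)|+\tfrac12\sum_{i,j}|\partial^2_{ij}f_1(x)-\partial^2_{ij}f_2(x)|\Big];$$ for some $\gamma>0$ and all $f_1,f_2\in\mathcal H^2_{(0)}$,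 $\langle f_1-f_2,\mathcal Lf_1-\mathcal Lf_2\rangle\le-\gamma\|f_1-f_2\|^2$; and $\mathcal L$ is Gateaux differentiable, that is, for all $w,h\in\mathcal H^2$ the limit $\lim_{\epsilon\to0}(\mathcal L(w+\epsilon h)-\mathcal L(w))/\epsilon$ exists in $L^2$. (2) $f\in\mathcal H^2$, and there is $u\in\mathcal H^2$ with $\mathcal Lu=0$ and $u=f$ on $\partial\Omega$ in the sense of traces, i.e. $u-f\in\mathcal H^1_0$. (3) $\eta:\mathbb R^n\to\mathbb R$ is $C^3$ with bounded derivatives up to order $3$, $0<\eta<1$ in $\Omega$, and $\eta=0$, $\nabla\eta\ne0$ on $\partial\Omega$. (4) $\sigma:\mathbb R\to\mathbb R$ is non-constant and $C^4$ with bounded derivatives up to order $4$. (5) $c,w,b$ are independent random variables with values in $\mathbb R,\mathbb R^n,\mathbb R$; $c$ is bounded with $\mathbb E[c]=0$; the law of $(w,b)$ charges every nonempty open subset of $\mathbb R^{n+1}$; $\mathbb E|w_k|^3<\infty$ for all $k$ and $\mathbb E|b|<\infty$. Define $$B(x,y)=\eta(x)\eta(y)\,\mathbb E\big[\sigma(w\cdot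 x+b)\sigma(w\cdot y+b)+c^2\sigma'(w\cdot x+b)\sigma'(w\cdot y+b)(x\cdot y+1)\big],$$ $$(\mathcal Bv)(y)=\int_\Omega B(x,y)v(x)\,d\mu(x),$$ let $\alpha>0$, and let $(Q_t)_{t\ge0}$ be a differentiable curve in $\mathcal H^2$ with $\frac{dQ_t}{dt}=\alpha\,\mathcal B\mathcal L(Q_t)$ for all $t\ge0$ and $Q_0=(1-\eta)f$. Call a set $A\subset[0,\infty)$ exceptional if it has finite Lebesgue measure and $\|\mathcal B\mathcal LQ_{t_k}\|\to0$ for every sequence $t_k\to\infty$ in $[0,\infty)\setminus A$. Then a measurable exceptional set exists, and for every exceptional set $A$ and every sequence $t_k\to\infty$ in $[0,\infty)\setminus A$, the sequence $\mathcal LQ_{t_k}$ converges weakly to $0$ in $L^2$ if and only if it is bounded in $L^2$. -/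

import Mathlib

open MeasureTheory Filter Topology
open scoped ENNReal NNReal InnerProductSpace Distributions

noncomputable section

namespace QPDE

/-- Euclidean space `ℝⁿ`. -/
abbrev Eucl (n : ℕ) : Type := EuclideanSpace ℝ (Fin n)

/-- The standard basis vector `e_i` of `ℝⁿ`. -/
abbrev stdVec {n : ℕ} (i : Fin n) : Eucl n := EuclideanSpace.single i (1 : ℝ)

/-- The class `C^k_b`: `k` times continuously differentiable, with all derivatives of order
at most `k` bounded on the whole space. -/
def IsCkb {V : Type*} [NormedAddCommGroup V] [NormedSpace ℝ V] (k : ℕ) (g : V → ℝ) : Prop :=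
  ContDiff ℝ k g ∧ ∀ j ≤ k, ∃ C : ℝ, ∀ x, ‖iteratedFDeriv ℝ j g x‖ ≤ C

/-- `Ω` has a `C^{3,a}` boundary: near each boundary point, `Ω` is the region strictly above the
graph of a `C^{3,a}` function over a hyperplane `ν^⊥`, in the direction of the unit vector `ν`. -/
def HasC3HolderBoundary {n : ℕ} (Ω : Set (Eucl n)) (a : ℝ≥0) : Prop :=
  ∀ x₀ ∈ frontier Ω, ∃ r : ℝ, 0 < r ∧ ∃ ν : Eucl n, ‖ν‖ = 1 ∧
    ∃ g : ((ℝ ∙ ν)ᗮ : Submodule ℝ (Eucl n)) → ℝ,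
      ContDiff ℝ 3 g ∧ (∃ C : ℝ≥0, HolderWith C a (iteratedFDeriv ℝ 3 g)) ∧
      ∀ x ∈ Metric.ball x₀ r,
        (x ∈ Ω ↔ g ((ℝ ∙ ν)ᗮ.orthogonalProjectionOnto x) < ⟪ν, x⟫_ℝ)

/-- A density on the open set `Ω`, continuous on `Ω` and bounded away from `0` and `∞` there. -/
structure Density {n : ℕ} (Ω : TopologicalSpace.Opens (Eucl n)) where
  /-- the density with respect to Lebesgue measure (only its values on `Ω` matter) -/
  rho : Eucl n → ℝ
  continuousOn : ContinuousOn rho Ω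
  bounds : ∃ m M : ℝ, 0 < m ∧ ∀ x ∈ Ω, m ≤ rho x ∧ rho x ≤ M

section Spaces

variable {n : ℕ} {Ω : TopologicalSpace.Opens (Eucl n)}

/-- The measure `μ` on `Ω` with the given density with respect to Lebesgue measure. -/
def Density.measure (D : Density Ω) : Measure (Eucl n) :=
  (volume.restrict (Ω : Set (Eucl n))).withDensity (fun x => ENNReal.ofReal (D.rho x))

/-- The space `L² = L²(Ω, μ)`. -/
abbrev Density.L2 (D : Density Ω) : Type := Lp ℝ 2 D.measure

theorem Density.restrict_le (D : Density Ω) :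
    ∃ K : ℝ≥0∞, K ≠ ∞ ∧ volume.restrict (Ω : Set (Eucl n)) ≤ K • D.measure := by
  obtain ⟨m, M, hm, hb⟩ := D.bounds
  have hm0 : ENNReal.ofReal m ≠ 0 := by simpa using hm
  refine ⟨(ENNReal.ofReal m)⁻¹, ENNReal.inv_ne_top.2 hm0, ?_⟩
  have h1 : ENNReal.ofReal m • volume.restrict (Ω : Set (Eucl n)) ≤ D.measure := by
    rw [← withDensity_const]
    refine withDensity_mono ?_
    filter_upwards [ae_restrict_mem Ω.isOpen.measurableSet] with x hx
    exact ENNReal.ofReal_le_ofReal (hb x hx).1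
  intro s
  have h2 := h1 s
  simp only [Measure.smul_apply, smul_eq_mul] at h2 ⊢
  calc volume.restrict (Ω : Set (Eucl n)) s
      = (ENNReal.ofReal m)⁻¹ * (ENNReal.ofReal m * volume.restrict (Ω : Set (Eucl n)) s) := by
        rw [← mul_assoc, ENNReal.inv_mul_cancel hm0 ENNReal.ofReal_ne_top, one_mul]
    _ ≤ _ := by gcongr

theorem Density.absolutelyContinuous (D : Density Ω) :
    volume.restrict (Ω : Set (Eucl n)) ≪ D.measure := by
  obtain ⟨K, -, hK⟩ := D.restrict_le
  exact (Measure.absolutelyContinuous_of_le hK).trans Measure.smul_absolutelyContinuous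

theorem Density.memLp_restrict (D : Density Ω) (u : D.L2) :
    MemLp u 2 (volume.restrict (Ω : Set (Eucl n))) := by
  obtain ⟨K, hK, h⟩ := D.restrict_le
  exact (Lp.memLp u).of_measure_le_smul hK h

/-- `g ∈ L²` is the weak derivative `∂_i u` of `u ∈ L²` on `Ω`:
`∫_Ω u ∂_iφ dx = - ∫_Ω g φ dx` (Lebesgue measure) for all test functions `φ ∈ C_c^∞(Ω)`. -/
def IsWeakDeriv (D : Density Ω) (i : Fin n) (u g : D.L2) : Prop :=
  ∀ φ : 𝓓(Ω, ℝ),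
    ∫ x in (Ω : Set (Eucl n)), u x * fderiv ℝ φ x (stdVec i)
      = - ∫ x in (Ω : Set (Eucl n)), g x * φ x

theorem TestFunction.memLp {ν : Measure (Eucl n)} [IsFiniteMeasureOnCompacts ν]
    (φ : 𝓓(Ω, ℝ)) : MemLp φ 2 ν :=
  φ.continuous.memLp_of_hasCompactSupport φ.hasCompactSupport

theorem TestFunction.memLp_deriv {ν : Measure (Eucl n)} [IsFiniteMeasureOnCompacts ν]
    (φ : 𝓓(Ω, ℝ)) (v : Eucl n) : MemLp (fun x => fderiv ℝ φ x v) 2 ν := by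
  have h : ContDiff ℝ (⊤ : ℕ∞) φ := φ.contDiff
  refine Continuous.memLp_of_hasCompactSupport ?_ ?_
  · exact (h.continuous_fderiv (by simp)).clm_apply continuous_const
  · exact φ.hasCompactSupport.fderiv_apply ℝ v

theorem IsWeakDeriv.zero (D : Density Ω) (i : Fin n) : IsWeakDeriv D i 0 0 := by
  intro φ
  have h : ((0 : D.L2) : Eucl n → ℝ) =ᵐ[volume.restrict (Ω : Set (Eucl n))] 0 :=
    D.absolutelyContinuous.ae_le (Lp.coeFn_zero ℝ 2 D.measure)
  rw [integral_eq_zero_of_ae, integral_eq_zero_of_ae, neg_zero]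
  · filter_upwards [h] with x hx
    simp only [hx, Pi.zero_apply, zero_mul]
  · filter_upwards [h] with x hx
    simp only [hx, Pi.zero_apply, zero_mul]

theorem IsWeakDeriv.add {D : Density Ω} {i : Fin n} {u g u' g' : D.L2}
    (h : IsWeakDeriv D i u g) (h' : IsWeakDeriv D i u' g') :
    IsWeakDeriv D i (u + u') (g + g') := by
  intro φ
  have key : ∀ (a b : D.L2) (ψ : Eucl n → ℝ),
      MemLp ψ 2 (volume.restrict (Ω : Set (Eucl n))) →
      ∫ x in (Ω : Set (Eucl n)), (a + b : D.L2) x * ψ x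
        = (∫ x in (Ω : Set (Eucl n)), a x * ψ x) + ∫ x in (Ω : Set (Eucl n)), b x * ψ x := by
    intro a b ψ hψ
    have ha : Integrable (fun x => a x * ψ x) (volume.restrict (Ω : Set (Eucl n))) :=
      (D.memLp_restrict a).integrable_mul hψ
    have hb : Integrable (fun x => b x * ψ x) (volume.restrict (Ω : Set (Eucl n))) :=
      (D.memLp_restrict b).integrable_mul hψ
    rw [← integral_add ha hb]
    refine integral_congr_ae ?_
    filter_upwards [D.absolutelyContinuous.ae_le (Lp.coeFn_add a b)] with x hx
    rw [hx, Pi.add_apply, add_mul]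
  rw [key _ _ _ (TestFunction.memLp_deriv φ _), key _ _ _ (TestFunction.memLp φ), h φ, h' φ]
  ring

theorem IsWeakDeriv.smul {D : Density Ω} {i : Fin n} {u g : D.L2} (c : ℝ)
    (h : IsWeakDeriv D i u g) : IsWeakDeriv D i (c • u) (c • g) := by
  intro φ
  have key : ∀ (a : D.L2) (ψ : Eucl n → ℝ),
      ∫ x in (Ω : Set (Eucl n)), (c • a : D.L2) x * ψ x
        = c * ∫ x in (Ω : Set (Eucl n)), a x * ψ x := by
    intro a ψ
    rw [← integral_const_mul]
    refine integral_congr_ae ?_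
    filter_upwards [D.absolutelyContinuous.ae_le (Lp.coeFn_smul c a)] with x hx
    simp [hx, mul_assoc]
  rw [key, key, h φ]
  ring

/-- Indices of the components of a second-order jet: the value, the first derivatives `∂_i`, and
the second derivatives `∂_i∂_j`. -/
abbrev JetIndex (n : ℕ) : Type := Unit ⊕ Fin n ⊕ (Fin n × Fin n)

/-- The Sobolev space `H²(Ω, μ)` as a space of jets. A function is stored with its (unique) weak derivatives of order
one and two, all in `L²`, so that `‖F‖² = ‖u‖² + ∑_i ‖∂_i u‖² + ∑_{i,j} ‖∂_i∂_j u‖²`. -/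
def sobolevJets (D : Density Ω) : Submodule ℝ (PiLp 2 (fun _ : JetIndex n => D.L2)) where
  carrier := {F | (∀ i, IsWeakDeriv D i (F (Sum.inl ())) (F (Sum.inr (Sum.inl i)))) ∧
    ∀ i j, IsWeakDeriv D j (F (Sum.inr (Sum.inl i))) (F (Sum.inr (Sum.inr (i, j))))}
  zero_mem' := ⟨fun i => IsWeakDeriv.zero D i, fun _ j => IsWeakDeriv.zero D j⟩
  add_mem' := fun hF hG => ⟨fun i => (hF.1 i).add (hG.1 i), fun i j => (hF.2 i j).add (hG.2 i j)⟩
  smul_mem' := fun c _ hF => ⟨fun i => (hF.1 i).smul c, fun i j => (hF.2 i j).smul c⟩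

/-- The Sobolev space `H²(Ω, μ)`. -/
abbrev H2 (D : Density Ω) : Type := sobolevJets D

variable {D : Density Ω}

/-- The underlying `L²` function of an element of `H²`. -/
def H2.fn (F : H2 D) : D.L2 := F.1 (Sum.inl ())

/-- The weak derivative `∂_i` of an element of `H²`. -/
def H2.d (F : H2 D) (i : Fin n) : D.L2 := F.1 (Sum.inr (Sum.inl i))

/-- The weak second derivative `∂_i∂_j` of an element of `H²`. -/
def H2.dd (F : H2 D) (i j : Fin n) : D.L2 := F.1 (Sum.inr (Sum.inr (i, j)))

/-- Zero boundary trace: `F ∈ H² ∩ H¹₀`, where `H¹₀` is the closure of `C_c^∞(Ω)` in `H¹`. -/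
def ZeroTrace (F : H2 D) : Prop :=
  ∃ φ : ℕ → 𝓓(Ω, ℝ),
    Tendsto (fun k => eLpNorm (fun x => F.fn x - φ k x) 2 D.measure) atTop (𝓝 0) ∧
    ∀ i, Tendsto (fun k => eLpNorm (fun x => F.d i x - fderiv ℝ (φ k) x (stdVec i)) 2 D.measure)
      atTop (𝓝 0)

/-- Pointwise Lipschitz continuity of the operator `𝓛` in the second-order jet. -/
def PointwiseLipschitz (L : H2 D → D.L2) : Prop :=
  ∃ C : ℝ, ∀ f₁ f₂ : H2 D, ∀ᵐ x ∂D.measure,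
    |L f₁ x - L f₂ x| ≤ C * (|f₁.fn x - f₂.fn x| + ∑ i, |f₁.d i x - f₂.d i x|
      + 1 / 2 * ∑ i, ∑ j, |f₁.dd i j x - f₂.dd i j x|)

/-- Strong monotonicity of `𝓛` on `H² ∩ H¹₀`. -/
def StronglyMonotone (L : H2 D → D.L2) : Prop :=
  ∃ γ : ℝ, 0 < γ ∧ ∀ f₁ f₂ : H2 D, ZeroTrace f₁ → ZeroTrace f₂ →
    ⟪f₁.fn - f₂.fn, L f₁ - L f₂⟫_ℝ ≤ -γ * ‖f₁.fn - f₂.fn‖ ^ 2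

/-- `u ∈ H²` solves `𝓛u = 0` in `Ω`, `u = f` on `∂Ω` (in the sense of traces). -/
def IsSolution (L : H2 D → D.L2) (f u : H2 D) : Prop :=
  L u = 0 ∧ ZeroTrace (u - f)

/-- `𝓛 : H² → L²` is Gateaux differentiable: at every point and in every direction the
directional derivative exists in `L²`. -/
def GateauxDifferentiable (L : H2 D → D.L2) : Prop :=
  ∀ w h : H2 D, LineDifferentiableAt ℝ L w h

end Spaces

/-- The auxiliary function `η ∈ C³_b(ℝⁿ)`: `0 < η < 1` in `Ω`, and `η` vanishes on `∂Ω` while its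
derivative does not. As `η` is constant along `∂Ω`, the latter says that the normal derivative of
`η` is nonzero. -/
structure IsAuxiliary {n : ℕ} (Ω : Set (Eucl n)) (η : Eucl n → ℝ) : Prop where
  ckb : IsCkb 3 η
  mem_Ioo : ∀ x ∈ Ω, 0 < η x ∧ η x < 1
  eq_zero : ∀ x ∈ frontier Ω, η x = 0
  fderiv_ne_zero : ∀ x ∈ frontier Ω, fderiv ℝ η x ≠ 0

/-- The activation function: `σ ∈ C⁴_b(ℝ)` and `σ` is not constant. -/
structure IsActivation (σ : ℝ → ℝ) : Prop where
  ckb : IsCkb 4 σ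
  nonconstant : ¬ ∃ a : ℝ, ∀ x, σ x = a

/-- The random initial parameters `c, w, b` of a hidden unit. -/
structure IsInitialization {n : ℕ} {S : Type*} [MeasurableSpace S] (P : Measure S)
    (c : S → ℝ) (w : S → Eucl n) (b : S → ℝ) : Prop where
  measurable_c : Measurable c
  measurable_w : Measurable w
  measurable_b : Measurable b
  indep_w_b : ProbabilityTheory.IndepFun w b P
  indep_c_wb : ProbabilityTheory.IndepFun c (fun s => (w s, b s)) P
  bounded_c : ∃ K : ℝ, ∀ᵐ s ∂P, |c s| < K
  mean_c : ∫ s, c s ∂P = 0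
  full_support : ∀ U : Set (Eucl n × ℝ), IsOpen U → U.Nonempty → 0 < P {s | (w s, b s) ∈ U}
  moment_w : ∀ k, Integrable (fun s => |w s k| ^ 3) P
  moment_b : Integrable b P

/-- The limit kernel
`B(x,y) = η(x)η(y) E[σ(w·x+b) σ(w·y+b) + c² σ'(w·x+b) σ'(w·y+b) (x·y+1)]`. -/
def limitKernel {n : ℕ} {S : Type*} [MeasurableSpace S] (P : Measure S)
    (c : S → ℝ) (w : S → Eucl n) (b : S → ℝ) (σ : ℝ → ℝ) (η : Eucl n → ℝ) (x y : Eucl n) : ℝ :=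
  η x * η y * ∫ s, (σ (⟪w s, x⟫_ℝ + b s) * σ (⟪w s, y⟫_ℝ + b s)
    + c s ^ 2 * deriv σ (⟪w s, x⟫_ℝ + b s) * deriv σ (⟪w s, y⟫_ℝ + b s) * (⟪x, y⟫_ℝ + 1)) ∂P

section Dynamics

variable {n : ℕ} {Ω : TopologicalSpace.Opens (Eucl n)} {D : Density Ω}

/-- The integral operator `(𝓑v)(y) = ∫_Ω B(x,y) v(x) dμ(x)` with kernel `B`, on `L²`. -/
def integralOp (D : Density Ω) (B : Eucl n → Eucl n → ℝ) (v : D.L2) (y : Eucl n) : ℝ :=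
  ∫ x, B x y * v x ∂D.measure

/-- The wide network limit: the `H²`-valued curve `(Q_t)_{t ≥ 0}`, differentiable in `H²`, with
`dQ_t/dt = α 𝓑𝓛(Q_t)` for `t ≥ 0` and `Q_0 = (1-η) f`. -/
def IsWideNetworkLimit (α : ℝ) (B : Eucl n → Eucl n → ℝ) (L : H2 D → D.L2) (η : Eucl n → ℝ)
    (f : H2 D) (Q : ℝ → H2 D) : Prop :=
  ((Q 0).fn =ᵐ[D.measure] fun y => (1 - η y) * f.fn y) ∧
  ∀ t : ℝ, 0 ≤ t → ∃ q : H2 D, HasDerivWithinAt Q q (Set.Ici 0) t ∧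
    q.fn =ᵐ[D.measure] fun y => α * integralOp D B (L (Q t)) y

/-- A set `A ⊆ [0,∞)` of finite Lebesgue measure such that `‖𝓑𝓛Q_{t_k}‖_{L²} → 0` along every
sequence of times `t_k → ∞` that avoids `A`. -/
def IsExceptionalSet (B : Eucl n → Eucl n → ℝ) (L : H2 D → D.L2) (Q : ℝ → H2 D)
    (A : Set ℝ) : Prop :=
  A ⊆ Set.Ici 0 ∧ volume A < ∞ ∧
  ∀ t : ℕ → ℝ, (∀ k, t k ∈ Set.Ici 0 \ A) → Tendsto t atTop atTop →
    Tendsto (fun k => eLpNorm (integralOp D B (L (Q (t k)))) 2 D.measure) atTop (𝓝 0)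

end Dynamics

end QPDE

end

/-! Let T be 𝓑 regarded as an operator on L². The energy E(t) = ⟪T𝓛Q_t, 𝓛Q_t⟫ is nonnegative. With q
= dQ_t/dt = αT𝓛Q_t and ℓ the derivative of 𝓛 at Q_t in direction q, symmetry of T gives E' =
2⟪T𝓛Q_t, ℓ⟫ = (2/α)⟪q, ℓ⟫, and strong monotonicity bounds this by -2γα‖T𝓛Q_t‖². Hence ‖T𝓛Q_t‖² is
integrable in time (`IsWideNetworkLimit.integrableOn`), and an integrable function tends to zero
outside a set of finite measure (`exists_set_tendsto_zero`).

The delicate point is monotonicity: it is assumed only between functions of zero trace, and Q_t is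
not one. The pointwise Lipschitz bound makes 𝓛 local, so base point and increment can both be cut
off inside Ω without changing 𝓛 where the increment lives. The cutoffs are θ(η/ε). An increment with
|h| ≤ Kη is small enough near the boundary to absorb the ε⁻¹ and ε⁻² from their derivatives, so ε →
0 is a dominated limit (`inner_le_of_abs_le`). Every function in the range of T has such a bound,
because the kernel carries the factor η(y).

T is analysed in `exists_limitOperator`. Its kernel is a sum of expectations of products of random
features, so T is symmetric and nonnegative. If ⟪Tv, v⟫ = 0, then ηv is orthogonal to almost every,
and by continuity and full support to every, ridge function σ(w·x+b). A bounded nonconstant σ is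
discriminatory (`ae_eq_zero_of_forall_integral_ridge`), so v = 0.

Finally, a symmetric injective T has dense range, so Tx_k → 0 and boundedness of x_k give weak
convergence to 0 (`tendsto_inner_of_bounded`). Conversely, weakly convergent sequences are bounded
by the uniform boundedness principle. -/

noncomputable section

namespace QPDE

set_option linter.unusedSectionVars false

/-! ### Mollification and its convergence in L² -/

section Mollification

variable {E : Type*} [NormedAddCommGroup E] [NormedSpace ℝ E] [FiniteDimensional ℝ E]
  [MeasureSpace E] [BorelSpace E] [(volume : Measure E).IsAddHaarMeasure]

/-- Mollification by a normalised bump function. -/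
def mollify (φ : ContDiffBump (0 : E)) (F : E → ℝ) : E → ℝ :=
  convolution (φ.normed volume) F (ContinuousLinearMap.lsmul ℝ ℝ) volume

theorem mollify_apply (φ : ContDiffBump (0 : E)) (F : E → ℝ) (x : E) :
    mollify φ F x = ∫ t, φ.normed volume t * F (x - t) := by
  simp [mollify, convolution_def]

theorem mollify_apply_swap (φ : ContDiffBump (0 : E)) (F : E → ℝ) (x : E) :
    mollify φ F x = ∫ t, φ.normed volume (x - t) * F t := by
  simp [mollify, convolution_eq_swap]

/-- The probability measure of a normalised bump function. -/
def bumpMeasure (φ : ContDiffBump (0 : E)) : Measure E :=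
  volume.withDensity fun t => ENNReal.ofReal (φ.normed volume t)

theorem measurable_ofReal_normed (φ : ContDiffBump (0 : E)) :
    Measurable fun t => ENNReal.ofReal (φ.normed (volume : Measure E) t) :=
  ENNReal.measurable_ofReal.comp φ.continuous_normed.measurable

instance (φ : ContDiffBump (0 : E)) : IsProbabilityMeasure (bumpMeasure φ) := by
  constructor
  rw [bumpMeasure, withDensity_apply _ MeasurableSet.univ, Measure.restrict_univ,
    ← ofReal_integral_eq_lintegral_ofReal φ.integrable_normed
      (Eventually.of_forall φ.nonneg_normed), φ.integral_normed, ENNReal.ofReal_one]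

/-- Viewing the kernel as a probability measure lets Jensen's inequality be applied to the average.
-/
theorem enorm_mollify_le (φ : ContDiffBump (0 : E)) {F : E → ℝ} (hF : Measurable F) (x : E) :
    ‖mollify φ F x‖ₑ ≤ ∫⁻ t, ‖F (x - t)‖ₑ ∂bumpMeasure φ := by
  rw [mollify_apply]
  refine (enorm_integral_le_lintegral_enorm _).trans (le_of_eq ?_)
  rw [bumpMeasure, lintegral_withDensity_eq_lintegral_mul _ (measurable_ofReal_normed φ)
    (by fun_prop)]
  refine lintegral_congr fun t => ?_
  rw [enorm_mul, Pi.mul_apply, Real.enorm_of_nonneg (φ.nonneg_normed t)]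

theorem measurable_mollify (φ : ContDiffBump (0 : E)) {F : E → ℝ} (hF : Measurable F) :
    StronglyMeasurable (mollify φ F) := by
  have : mollify φ F = fun x => ∫ t, φ.normed volume t * F (x - t) :=
    funext (mollify_apply φ F)
  rw [this]
  refine StronglyMeasurable.integral_prod_right (f := fun x t : E =>
    φ.normed volume t * F (x - t)) (Measurable.stronglyMeasurable ?_)
  exact (φ.continuous_normed.measurable.comp measurable_snd).mul
    (hF.comp (measurable_fst.sub measurable_snd))

/-- Young's inequality for a kernel of mass one: on a probability space the L¹ norm is at most the
L² norm; then Tonelli and translation invariance remove the average. -/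
theorem eLpNorm_mollify_le (φ : ContDiffBump (0 : E)) {F : E → ℝ} (hF : Measurable F) :
    eLpNorm (mollify φ F) 2 volume ≤ eLpNorm F 2 volume := by
  have key : ∀ G : E → ℝ, eLpNorm G 2 volume = (∫⁻ x, ‖G x‖ₑ ^ (2 : ℝ)) ^ ((1 : ℝ) / 2) := by
    intro G
    rw [eLpNorm_eq_lintegral_rpow_enorm_toReal (by simp) (by simp)]; simp
  rw [key, key]
  refine ENNReal.rpow_le_rpow ?_ (by norm_num)
  have h1 : ∀ x, ‖mollify φ F x‖ₑ ^ (2 : ℝ) ≤ ∫⁻ t, ‖F (x - t)‖ₑ ^ (2 : ℝ) ∂bumpMeasure φ := by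
    intro x
    have hm : Measurable fun t => F (x - t) := by fun_prop
    have h2 := eLpNorm_le_eLpNorm_of_exponent_le (μ := bumpMeasure φ) (p := 1) (q := 2)
      (f := fun t => F (x - t)) (by norm_num) hm.aestronglyMeasurable
    rw [eLpNorm_one_eq_lintegral_enorm, eLpNorm_eq_lintegral_rpow_enorm_toReal (by simp) (by simp)]
      at h2
    have h3 := ENNReal.rpow_le_rpow ((enorm_mollify_le φ hF x).trans h2) (z := 2) (by norm_num)
    rw [← ENNReal.rpow_mul] at h3
    simpa using h3
  refine (lintegral_mono h1).trans (le_of_eq ?_)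
  rw [lintegral_lintegral_swap (by fun_prop)]
  simp_rw [lintegral_sub_right_eq_self (fun x => ‖F x‖ₑ ^ (2 : ℝ))]
  simp

theorem mollify_sub (φ : ContDiffBump (0 : E)) {F G : E → ℝ}
    (hF : LocallyIntegrable F) (hG : LocallyIntegrable G) :
    mollify φ (F - G) = mollify φ F - mollify φ G := by
  have hc : ∀ {H : E → ℝ}, LocallyIntegrable H → ConvolutionExists (φ.normed volume) H
      (ContinuousLinearMap.lsmul ℝ ℝ) volume := fun hH =>
    φ.hasCompactSupport_normed.convolutionExists_left _ φ.continuous_normed hH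
  have h2 := (hc hF).distrib_add (hc (hG.smul (-1 : ℝ)))
  rw [convolution_smul] at h2
  simpa [mollify, sub_eq_add_neg] using h2

theorem HasCompactSupport.mollify (φ : ContDiffBump (0 : E)) {F : E → ℝ}
    (hF : HasCompactSupport F) : HasCompactSupport (mollify φ F) :=
  HasCompactSupport.convolution _ φ.hasCompactSupport_normed hF

theorem support_mollify_subset (φ : ContDiffBump (0 : E)) {F : E → ℝ} :
    Function.support (mollify φ F) ⊆ Metric.thickening φ.rOut (Function.support F) := by
  intro x hx
  obtain ⟨a, ha, b, hb, rfl⟩ := support_convolution_subset (ContinuousLinearMap.lsmul ℝ ℝ) hx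
  rw [φ.support_normed_eq] at ha
  refine Metric.mem_thickening_iff.2 ⟨b, hb, ?_⟩
  simpa [dist_eq_norm] using ha

theorem contDiff_mollify (φ : ContDiffBump (0 : E)) {F : E → ℝ} (hF : LocallyIntegrable F)
    {k : ℕ∞} : ContDiff ℝ k (mollify φ F) :=
  φ.hasCompactSupport_normed.contDiff_convolution_left _ φ.contDiff_normed hF

theorem dist_mollify_le (φ : ContDiffBump (0 : E)) {F : E → ℝ} (hF : Continuous F) {x : E}
    {ε : ℝ} (h : ∀ y ∈ Metric.ball x φ.rOut, dist (F y) (F x) ≤ ε) :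
    dist (mollify φ F x) (F x) ≤ ε :=
  φ.dist_normed_convolution_le hF.aestronglyMeasurable h

/-- Mollifications of a uniformly continuous function converge uniformly. -/
theorem tendsto_mollify_of_uniformContinuous {φ : ℕ → ContDiffBump (0 : E)}
    (hφ : Tendsto (fun k => (φ k).rOut) atTop (𝓝 0)) {F : E → ℝ} (hF : UniformContinuous F)
    {ε : ℝ} (hε : 0 < ε) : ∀ᶠ k in atTop, ∀ x, |mollify (φ k) F x - F x| ≤ ε := by
  obtain ⟨δ, hδ, h⟩ := Metric.uniformContinuous_iff.1 hF ε hε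
  filter_upwards [hφ.eventually (gt_mem_nhds hδ)] with k hk x
  exact dist_mollify_le (φ k) hF.continuous fun y hy =>
    (h ((Metric.mem_ball.1 hy).trans hk)).le

/-- Once the radius is below 1, everything vanishes off the closed 1-neighbourhood of the support, a
fixed compact set, so uniform convergence implies L² convergence. -/
theorem tendsto_eLpNorm_mollify_sub_of_continuous {φ : ℕ → ContDiffBump (0 : E)}
    (hφ : Tendsto (fun k => (φ k).rOut) atTop (𝓝 0)) {F : E → ℝ} (hF : Continuous F)
    (hc : HasCompactSupport F) :
    Tendsto (fun k => eLpNorm (mollify (φ k) F - F) 2 volume) atTop (𝓝 0) := by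
  set K := Metric.cthickening 1 (tsupport F) with hK
  have hKc : IsCompact K := hc.isCompact.cthickening
  have hsup : ∀ᶠ k in atTop, ∀ x ∉ K, (mollify (φ k) F - F) x = 0 := by
    filter_upwards [hφ.eventually (gt_mem_nhds one_pos)] with k hk x hx
    have h1 : F x = 0 := by
      by_contra h
      exact hx (Metric.self_subset_cthickening _ (subset_tsupport _ h))
    have h2 : mollify (φ k) F x = 0 := by
      by_contra h
      refine hx (Metric.thickening_subset_cthickening _ _ ?_)
      exact Metric.thickening_mono hk.le _
        (Metric.thickening_subset_of_subset _ (subset_tsupport F) (support_mollify_subset _ h))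
    simp [h1, h2]
  have hfin : volume K ≠ ∞ := hKc.measure_lt_top.ne
  rw [ENNReal.tendsto_nhds_zero]
  intro ε hε
  have hu := hc.uniformContinuous_of_continuous hF
  obtain ⟨δ, hδ, hδε⟩ : ∃ δ : ℝ, 0 < δ ∧
      volume K ^ (1 / (2 : ℝ≥0∞).toReal) * ENNReal.ofReal δ ≤ ε := by
    have : Tendsto (fun δ : ℝ => volume K ^ (1 / (2 : ℝ≥0∞).toReal) * ENNReal.ofReal δ)
        (𝓝[>] 0) (𝓝 0) := by
      have h := ENNReal.Tendsto.const_mul (a := volume K ^ (1 / (2 : ℝ≥0∞).toReal))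
        (ENNReal.tendsto_ofReal (tendsto_id (x := 𝓝 (0:ℝ))))
        (Or.inr (ENNReal.rpow_ne_top_of_nonneg (by positivity) hfin))
      simpa using h.mono_left nhdsWithin_le_nhds
    obtain ⟨δ, h1, h2⟩ := ((this.eventually (ge_mem_nhds hε)).and self_mem_nhdsWithin).exists
    exact ⟨δ, h2, h1⟩
  filter_upwards [hsup, tendsto_mollify_of_uniformContinuous hφ hu hδ] with k hk1 hk2
  have h3 : eLpNorm (mollify (φ k) F - F) 2 volume
      = eLpNorm (mollify (φ k) F - F) 2 (volume.restrict K) := by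
    rw [← eLpNorm_indicator_eq_eLpNorm_restrict hKc.isClosed.measurableSet]
    congr 1
    ext x
    by_cases hx : x ∈ K
    · simp [hx]
    · simpa [hx] using hk1 x hx
  rw [h3]
  refine (eLpNorm_le_of_ae_bound (C := δ) (Eventually.of_forall fun x => ?_)).trans ?_
  · exact hk2 x
  · simpa using hδε

/-- Mollifications of an `L²` function converge in `L²`. -/
theorem tendsto_eLpNorm_mollify_sub {φ : ℕ → ContDiffBump (0 : E)}
    (hφ : Tendsto (fun k => (φ k).rOut) atTop (𝓝 0)) {F : E → ℝ} (hm : Measurable F)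
    (hF : MemLp F 2 volume) :
    Tendsto (fun k => eLpNorm (mollify (φ k) F - F) 2 volume) atTop (𝓝 0) := by
  rw [ENNReal.tendsto_nhds_zero]
  intro ε hε
  have hε3 : ε / 3 ≠ 0 := by simp [hε.ne']
  obtain ⟨G, hGc, hFG, hG, hGm⟩ := hF.exists_hasCompactSupport_eLpNorm_sub_le (by simp) hε3
  filter_upwards [ENNReal.tendsto_nhds_zero.1
    (tendsto_eLpNorm_mollify_sub_of_continuous hφ hG hGc) (ε / 3)
      (pos_iff_ne_zero.2 hε3)] with k hk
  have hFl : LocallyIntegrable F volume := hF.locallyIntegrable (by norm_num)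
  have hGl : LocallyIntegrable G volume := hG.locallyIntegrable
  have h1 : mollify (φ k) F - F
      = mollify (φ k) (F - G) + ((mollify (φ k) G - G) + (G - F)) := by
    rw [mollify_sub _ hFl hGl]; abel
  have m1 := (measurable_mollify (φ k) (hm.sub hG.measurable)).aestronglyMeasurable
    (μ := (volume : Measure E))
  have m2 := ((measurable_mollify (φ k) hG.measurable).sub
    hG.measurable.stronglyMeasurable).aestronglyMeasurable (μ := (volume : Measure E))
  have m3 := (hG.measurable.sub hm).aestronglyMeasurable (μ := (volume : Measure E))
  rw [h1]
  calc _ ≤ _ := eLpNorm_add_le m1 (m2.add m3) (by norm_num)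
    _ ≤ ε / 3 + (ε / 3 + ε / 3) := by
      refine add_le_add ((eLpNorm_mollify_le _ (hm.sub hG.measurable)).trans hFG)
        ((eLpNorm_add_le m2 m3 (by norm_num)).trans (add_le_add hk ?_))
      rw [eLpNorm_sub_comm]; exact hFG
    _ = ε := by rw [← add_assoc, ENNReal.add_thirds]

/-- The bump functions with radii `δ / (2 (k + 1))` and `δ / (k + 1)`. -/
def bumpSeq (E : Type*) [NormedAddCommGroup E] {δ : ℝ} (hδ : 0 < δ) (k : ℕ) :
    ContDiffBump (0 : E) where
  rIn := δ / (2 * ((k : ℝ) + 1))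
  rOut := δ / ((k : ℝ) + 1)
  rIn_pos := by positivity
  rIn_lt_rOut := by
    have : (0 : ℝ) < k + 1 := by positivity
    exact div_lt_div_of_pos_left hδ this (by linarith)

theorem bumpSeq_rOut_le {δ : ℝ} (hδ : 0 < δ) (k : ℕ) : (bumpSeq E hδ k).rOut ≤ δ :=
  div_le_self hδ.le (by simp)

theorem tendsto_bumpSeq_rOut {δ : ℝ} (hδ : 0 < δ) :
    Tendsto (fun k => (bumpSeq E hδ k).rOut) atTop (𝓝 0) := by
  have := (tendsto_one_div_add_atTop_nhds_zero_nat (𝕜 := ℝ)).const_mul δ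
  simpa [bumpSeq, div_eq_mul_inv] using this

theorem fderiv_mollify (φ : ContDiffBump (0 : E)) {F : E → ℝ} (hF : ContDiff ℝ 1 F)
    (hc : HasCompactSupport F) (x v : E) :
    fderiv ℝ (mollify φ F) x v = mollify φ (fun y => fderiv ℝ F y v) x := by
  have hl : LocallyIntegrable (φ.normed (volume : Measure E)) volume :=
    φ.continuous_normed.locallyIntegrable
  rw [mollify, (hc.hasFDerivAt_convolution_right (ContinuousLinearMap.lsmul ℝ ℝ) hl hF x).fderiv,
    convolution_precompR_apply _ hl (hc.fderiv ℝ) (hF.continuous_fderiv one_ne_zero), mollify]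

/-- Here the derivative falls on the kernel, so that F may be merely L² and its weak derivative can
be brought in afterwards. -/
theorem fderiv_mollify_left (φ : ContDiffBump (0 : E)) {F : E → ℝ}
    (hF : LocallyIntegrable F volume) (x v : E) :
    fderiv ℝ (mollify φ F) x v = ∫ t, fderiv ℝ (φ.normed volume) (x - t) v * F t := by
  have hs : HasCompactSupport (φ.normed (volume : Measure E)) := φ.hasCompactSupport_normed
  have hd : ContDiff ℝ 1 (φ.normed (volume : Measure E)) := φ.contDiff_normed (n := 1)
  rw [mollify, ← convolution_flip, (hs.hasFDerivAt_convolution_right _ hF hd x).fderiv,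
    convolution_precompR_apply _ hF (hs.fderiv ℝ) (hd.continuous_fderiv one_ne_zero)]
  simp [convolution_def]

end Mollification

/-! ### Weak derivatives, compactly supported cutoffs and zero trace -/

section Cutoff

variable {n : ℕ} {Ω : TopologicalSpace.Opens (Eucl n)} {D : Density Ω}

theorem Density.measure_ac (D : Density Ω) :
    D.measure ≪ volume.restrict (Ω : Set (Eucl n)) :=
  withDensity_absolutelyContinuous _ _

theorem Density.measure_le (D : Density Ω) :
    ∃ K : ℝ≥0, D.measure ≤ K • volume.restrict (Ω : Set (Eucl n)) := by
  obtain ⟨m, M, hm, hb⟩ := D.bounds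
  refine ⟨M.toNNReal, ?_⟩
  rw [Density.measure]
  calc _ ≤ (volume.restrict (Ω : Set (Eucl n))).withDensity (fun _ => ENNReal.ofReal M) := by
        refine withDensity_mono ?_
        filter_upwards [ae_restrict_mem Ω.isOpen.measurableSet] with x hx
        exact ENNReal.ofReal_le_ofReal (hb x hx).2
    _ = _ := by rw [withDensity_const]; rfl

theorem Density.ae_mem (D : Density Ω) : ∀ᵐ x ∂D.measure, x ∈ Ω :=
  D.measure_ac (ae_restrict_mem Ω.isOpen.measurableSet)

theorem isFiniteMeasure_restrict (hΩ : Bornology.IsBounded (Ω : Set (Eucl n))) :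
    IsFiniteMeasure (volume.restrict (Ω : Set (Eucl n))) :=
  ⟨by simpa using hΩ.measure_lt_top⟩

theorem Density.isFiniteMeasure (D : Density Ω)
    (hΩ : Bornology.IsBounded (Ω : Set (Eucl n))) : IsFiniteMeasure D.measure := by
  have := isFiniteMeasure_restrict hΩ
  obtain ⟨K, hK⟩ := D.measure_le
  exact isFiniteMeasure_of_le _ hK

theorem Density.integrable_restrict (D : Density Ω)
    (hΩ : Bornology.IsBounded (Ω : Set (Eucl n))) (u : D.L2) :
    Integrable u (volume.restrict (Ω : Set (Eucl n))) := by
  have := isFiniteMeasure_restrict hΩ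
  exact (D.memLp_restrict u).integrable (by norm_num)

theorem tendsto_integral_mul_of_uniform {X : Type*} [MeasurableSpace X] {μ : Measure X}
    {u : X → ℝ} (hu : Integrable u μ) {ψ : ℕ → X → ℝ} {ψ₀ : X → ℝ}
    (hψ : ∀ k, Integrable (fun x => u x * ψ k x) μ) (hψ₀ : Integrable (fun x => u x * ψ₀ x) μ)
    (h : ∀ ε > 0, ∀ᶠ k in atTop, ∀ x, |ψ k x - ψ₀ x| ≤ ε) :
    Tendsto (fun k => ∫ x, u x * ψ k x ∂μ) atTop (𝓝 (∫ x, u x * ψ₀ x ∂μ)) := by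
  rw [Metric.tendsto_atTop']
  intro ε hε
  have hI : 0 ≤ ∫ x, |u x| ∂μ := integral_nonneg fun _ => abs_nonneg _
  obtain ⟨N, hN⟩ := eventually_atTop.1 (h (ε / (2 * ((∫ x, |u x| ∂μ) + 1))) (by positivity))
  refine ⟨N, fun k hk => ?_⟩
  rw [Real.dist_eq, ← integral_sub (hψ k) hψ₀]
  refine (abs_integral_le_integral_abs).trans_lt ?_
  calc ∫ x, |u x * ψ k x - u x * ψ₀ x| ∂μ
      ≤ ∫ x, |u x| * (ε / (2 * ((∫ x, |u x| ∂μ) + 1))) ∂μ := by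
        refine integral_mono ((hψ k).sub hψ₀).abs (hu.abs.mul_const _) fun x => ?_
        simp only
        rw [← mul_sub, abs_mul]
        exact mul_le_mul_of_nonneg_left (hN k hk.le x) (abs_nonneg _)
    _ = (∫ x, |u x| ∂μ) * (ε / (2 * ((∫ x, |u x| ∂μ) + 1))) := integral_mul_const _ _
    _ < ε := by
        rw [mul_div_assoc', div_lt_iff₀ (by positivity)]
        nlinarith

theorem integrable_mul_of_continuous {X : Type*} [MeasurableSpace X] [TopologicalSpace X]
    [OpensMeasurableSpace X] {μ : Measure X} {u ψ : X → ℝ} (hu : Integrable u μ)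
    (hψ : Continuous ψ) (hc : HasCompactSupport ψ) : Integrable (fun x => u x * ψ x) μ := by
  obtain ⟨C, hC⟩ := hψ.bounded_above_of_compact_support hc
  exact hu.mul_bdd hψ.aestronglyMeasurable (Eventually.of_forall hC)

/-- Weak derivatives may be tested against compactly supported `C¹` functions. -/
theorem IsWeakDeriv.integral_mul_fderiv (hΩ : Bornology.IsBounded (Ω : Set (Eucl n)))
    {i : Fin n} {u g : D.L2} (h : IsWeakDeriv D i u g) {φ : Eucl n → ℝ} (hφ : ContDiff ℝ 1 φ)
    (hc : HasCompactSupport φ) (hs : tsupport φ ⊆ Ω) :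
    ∫ x in (Ω : Set (Eucl n)), u x * fderiv ℝ φ x (stdVec i)
      = - ∫ x in (Ω : Set (Eucl n)), g x * φ x := by
  -- Mollifying at radius at most δ keeps the support in Ω, so the mollifications are genuine test
  -- functions.
  obtain ⟨δ, hδ, hδΩ⟩ := hc.isCompact.exists_cthickening_subset_open Ω.isOpen hs
  set ρ : ℕ → ContDiffBump (0 : Eucl n) := bumpSeq (Eucl n) hδ
  have hρ : Tendsto (fun k => (ρ k).rOut) atTop (𝓝 0) := tendsto_bumpSeq_rOut hδ
  have hsub : ∀ k, tsupport (mollify (ρ k) φ) ⊆ Ω := by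
    intro k
    refine (closure_minimal ?_ Metric.isClosed_cthickening).trans hδΩ
    refine (support_mollify_subset _).trans ?_
    exact (Metric.thickening_mono (bumpSeq_rOut_le hδ k) _).trans
      ((Metric.thickening_subset_cthickening _ _).trans
        (Metric.cthickening_subset_of_subset _ (subset_tsupport _)))
  have hcs : ∀ k, HasCompactSupport (mollify (ρ k) φ) := fun k => HasCompactSupport.mollify _ hc
  let Φ : ℕ → 𝓓(Ω, ℝ) := fun k => ⟨mollify (ρ k) φ,
    contDiff_mollify _ hφ.continuous.locallyIntegrable, hcs k, hsub k⟩
  have hd : Continuous fun x => fderiv ℝ φ x (stdVec i) :=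
    (hφ.continuous_fderiv one_ne_zero).clm_apply continuous_const
  have hdc : HasCompactSupport fun x => fderiv ℝ φ x (stdVec i) := hc.fderiv_apply ℝ _
  have hu := D.integrable_restrict hΩ u
  have hg := D.integrable_restrict hΩ g
  have lim1 : Tendsto (fun k => ∫ x in (Ω : Set (Eucl n)), u x * fderiv ℝ (Φ k) x (stdVec i))
      atTop (𝓝 (∫ x in (Ω : Set (Eucl n)), u x * fderiv ℝ φ x (stdVec i))) := by
    refine tendsto_integral_mul_of_uniform hu (fun k => ?_)
      (integrable_mul_of_continuous hu hd hdc) fun ε hε => ?_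
    · have hk : ContDiff ℝ 1 (Φ k) := contDiff_mollify (k := 1) _ hφ.continuous.locallyIntegrable
      exact integrable_mul_of_continuous hu
        ((hk.continuous_fderiv one_ne_zero).clm_apply continuous_const)
        ((hcs k).fderiv_apply ℝ _)
    · filter_upwards [tendsto_mollify_of_uniformContinuous hρ
        (hdc.uniformContinuous_of_continuous hd) hε] with k hk x
      have : fderiv ℝ (Φ k) x (stdVec i) = _ := fderiv_mollify (ρ k) hφ hc x (stdVec i)
      rw [this]
      exact hk x
  have lim2 : Tendsto (fun k => ∫ x in (Ω : Set (Eucl n)), g x * Φ k x)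
      atTop (𝓝 (∫ x in (Ω : Set (Eucl n)), g x * φ x)) := by
    refine tendsto_integral_mul_of_uniform hg (fun k => ?_)
      (integrable_mul_of_continuous hg hφ.continuous hc) fun ε hε => ?_
    · exact integrable_mul_of_continuous hg (Φ k).continuous (hcs k)
    · exact tendsto_mollify_of_uniformContinuous hρ
        (hc.uniformContinuous_of_continuous hφ.continuous) hε
  refine tendsto_nhds_unique lim1 ?_
  have : (fun k => ∫ x in (Ω : Set (Eucl n)), u x * fderiv ℝ (Φ k) x (stdVec i))
      = fun k => - ∫ x in (Ω : Set (Eucl n)), g x * Φ k x := funext fun k => h (Φ k)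
  rw [this]
  exact lim2.neg

theorem TestFunction.contDiff_one {k : ℕ∞} (hk : 1 ≤ k) (ψ : 𝓓^{k}(Ω, ℝ)) : ContDiff ℝ 1 ψ :=
  ψ.contDiff.of_le (by exact_mod_cast hk)

theorem TestFunction.continuous_fderiv_apply {k : ℕ∞} (hk : 1 ≤ k) (ψ : 𝓓^{k}(Ω, ℝ))
    (v : Eucl n) : Continuous fun x => fderiv ℝ ψ x v :=
  ((TestFunction.contDiff_one hk ψ).continuous_fderiv one_ne_zero).clm_apply continuous_const

/-- The product rule for a `C¹` cutoff, tested against an arbitrary `C¹` function. -/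
theorem IsWeakDeriv.integral_cutoff (hΩ : Bornology.IsBounded (Ω : Set (Eucl n)))
    {i : Fin n} {u g : D.L2} (h : IsWeakDeriv D i u g) {k : ℕ∞} (hk : 1 ≤ k) (ψ : 𝓓^{k}(Ω, ℝ))
    {φ : Eucl n → ℝ} (hφ : ContDiff ℝ 1 φ) :
    ∫ x in (Ω : Set (Eucl n)), ψ x * u x * fderiv ℝ φ x (stdVec i)
      = - ∫ x in (Ω : Set (Eucl n)),
        (ψ x * g x + fderiv ℝ ψ x (stdVec i) * u x) * φ x := by
  have hψ := TestFunction.contDiff_one hk ψ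
  have hψc := ψ.hasCompactSupport
  have hψd := TestFunction.continuous_fderiv_apply hk ψ (stdVec i)
  have hφd : Continuous fun x => fderiv ℝ φ x (stdVec i) :=
    (hφ.continuous_fderiv one_ne_zero).clm_apply continuous_const
  have hu := D.integrable_restrict hΩ u
  have hg := D.integrable_restrict hΩ g
  have hprod : ∀ x, fderiv ℝ (fun y => ψ y * φ y) x (stdVec i)
      = ψ x * fderiv ℝ φ x (stdVec i) + φ x * fderiv ℝ ψ x (stdVec i) := by
    intro x
    rw [fderiv_fun_mul (hψ.differentiable one_ne_zero x) (hφ.differentiable one_ne_zero x)]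
    simp
  have h1 := h.integral_mul_fderiv hΩ (φ := fun y => ψ y * φ y) (hψ.mul hφ) hψc.mul_right
    ((tsupport_mul_subset_left).trans ψ.tsupport_subset)
  have i1 := integrable_mul_of_continuous hu (ψ := fun x => ψ x * fderiv ℝ φ x (stdVec i))
    (ψ.continuous.mul hφd) hψc.mul_right
  have i2 := integrable_mul_of_continuous hu (ψ := fun x => fderiv ℝ ψ x (stdVec i) * φ x)
    (hψd.mul hφ.continuous) (hψc.fderiv_apply ℝ _).mul_right
  have i3 := integrable_mul_of_continuous hg (ψ := fun x => ψ x * φ x)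
    (ψ.continuous.mul hφ.continuous) hψc.mul_right
  have e1 : ∫ x in (Ω : Set (Eucl n)), u x * fderiv ℝ (fun y => ψ y * φ y) x (stdVec i)
      = (∫ x in (Ω : Set (Eucl n)), u x * (ψ x * fderiv ℝ φ x (stdVec i)))
        + ∫ x in (Ω : Set (Eucl n)), u x * (fderiv ℝ ψ x (stdVec i) * φ x) := by
    rw [← integral_add i1 i2]
    refine integral_congr_ae (Eventually.of_forall fun x => ?_)
    simp only [hprod]; ring
  have e2 : ∫ x in (Ω : Set (Eucl n)), (ψ x * g x + fderiv ℝ ψ x (stdVec i) * u x) * φ x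
      = (∫ x in (Ω : Set (Eucl n)), g x * (ψ x * φ x))
        + ∫ x in (Ω : Set (Eucl n)), u x * (fderiv ℝ ψ x (stdVec i) * φ x) := by
    rw [← integral_add i3 i2]
    refine integral_congr_ae (Eventually.of_forall fun x => ?_)
    simp only; ring
  have e3 : ∫ x in (Ω : Set (Eucl n)), ψ x * u x * fderiv ℝ φ x (stdVec i)
      = ∫ x in (Ω : Set (Eucl n)), u x * (ψ x * fderiv ℝ φ x (stdVec i)) := by
    refine integral_congr_ae (Eventually.of_forall fun x => ?_)
    simp only; ring
  rw [e1] at h1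
  rw [e2, e3]
  linarith

/-- The cutoffs inherit only the finite smoothness of η, so ψφ is not a smooth test function; this
is why weak derivatives had to be tested against C¹ functions. -/
theorem IsWeakDeriv.cutoff (hΩ : Bornology.IsBounded (Ω : Set (Eucl n)))
    {i : Fin n} {u g : D.L2} (h : IsWeakDeriv D i u g) {k : ℕ∞} (hk : 1 ≤ k) (ψ : 𝓓^{k}(Ω, ℝ))
    {v v' : D.L2} (hv : v =ᵐ[D.measure] fun x => ψ x * u x)
    (hv' : v' =ᵐ[D.measure] fun x => ψ x * g x + fderiv ℝ ψ x (stdVec i) * u x) :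
    IsWeakDeriv D i v v' := by
  intro φ
  have h1 := h.integral_cutoff hΩ hk ψ (φ := φ) (φ.contDiff.of_le (by simp))
  have a := D.absolutelyContinuous hv
  have a' := D.absolutelyContinuous hv'
  rw [integral_congr_ae (g := fun x => ψ x * u x * fderiv ℝ φ x (stdVec i)),
    integral_congr_ae (f := fun x => v' x * φ x)
      (g := fun x => (ψ x * g x + fderiv ℝ ψ x (stdVec i) * u x) * φ x)]
  · exact h1
  · filter_upwards [a'] with x hx using by rw [hx]
  · filter_upwards [a] with x hx using by rw [hx]

theorem memLp_continuous_mul {X : Type*} [MeasurableSpace X] [TopologicalSpace X]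
    [OpensMeasurableSpace X] {μ : Measure X} {u ψ : X → ℝ} (hu : MemLp u 2 μ)
    (hψ : Continuous ψ) (hc : HasCompactSupport ψ) : MemLp (fun x => ψ x * u x) 2 μ := by
  obtain ⟨C, hC⟩ := hψ.bounded_above_of_compact_support hc
  refine hu.of_le_mul (c := C) (hψ.aestronglyMeasurable.mul hu.1) (Eventually.of_forall fun x => ?_)
  rw [norm_mul]
  exact mul_le_mul_of_nonneg_right (hC x) (norm_nonneg _)

/-- The partial derivative of a `C²` test function, as a `C¹` test function. -/
def TestFunction.partialDeriv (ψ : 𝓓^{2}(Ω, ℝ)) (i : Fin n) : 𝓓^{1}(Ω, ℝ) where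
  toFun x := fderiv ℝ ψ x (stdVec i)
  contDiff' := (ψ.contDiff.fderiv_right (m := 1) (by norm_num [one_add_one_eq_two])).clm_apply
    contDiff_const
  hasCompactSupport' := ψ.hasCompactSupport.fderiv_apply ℝ _
  tsupport_subset' := (tsupport_fderiv_apply_subset ℝ _).trans ψ.tsupport_subset

theorem TestFunction.partialDeriv_apply (ψ : 𝓓^{2}(Ω, ℝ)) (i : Fin n) (x : Eucl n) :
    TestFunction.partialDeriv ψ i x = fderiv ℝ ψ x (stdVec i) := rfl

/-- `G = ψ F` as elements of `H²`, with the product rule for the derivatives. -/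
structure IsCutoffOf (ψ : 𝓓^{2}(Ω, ℝ)) (F G : H2 D) : Prop where
  fn : G.fn =ᵐ[D.measure] fun x => ψ x * F.fn x
  d : ∀ i, G.d i =ᵐ[D.measure] fun x => ψ x * F.d i x + fderiv ℝ ψ x (stdVec i) * F.fn x
  dd : ∀ i j, G.dd i j =ᵐ[D.measure] fun x =>
    (ψ x * F.dd i j x + fderiv ℝ ψ x (stdVec j) * F.d i x)
      + (fderiv ℝ ψ x (stdVec i) * F.d j x
        + fderiv ℝ (TestFunction.partialDeriv ψ i) x (stdVec j) * F.fn x)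

theorem exists_isCutoffOf (hΩ : Bornology.IsBounded (Ω : Set (Eucl n))) (ψ : 𝓓^{2}(Ω, ℝ))
    (F : H2 D) : ∃ G : H2 D, IsCutoffOf ψ F G := by
  have m : ∀ {k : ℕ∞} (χ : 𝓓^{k}(Ω, ℝ)) (u : D.L2), MemLp (fun x => χ x * u x) 2 D.measure :=
    fun χ u => memLp_continuous_mul (Lp.memLp u) χ.continuous χ.hasCompactSupport
  have md : ∀ {k : ℕ∞} (_ : 1 ≤ k) (χ : 𝓓^{k}(Ω, ℝ)) (u : D.L2) (i : Fin n),
      MemLp (fun x => fderiv ℝ χ x (stdVec i) * u x) 2 D.measure :=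
    fun hk χ u i => memLp_continuous_mul (Lp.memLp u)
      (TestFunction.continuous_fderiv_apply hk χ _) (χ.hasCompactSupport.fderiv_apply ℝ _)
  have h12 : (1 : ℕ∞) ≤ 2 := by norm_num
  let a : D.L2 := (m ψ F.fn).toLp _
  let b : Fin n → D.L2 := fun i => ((m ψ (F.d i)).add (md h12 ψ F.fn i)).toLp _
  let e : Fin n → Fin n → D.L2 := fun i j =>
    ((m ψ (F.dd i j)).add (md h12 ψ (F.d i) j)).toLp _
  let e' : Fin n → Fin n → D.L2 := fun i j =>
    ((m (TestFunction.partialDeriv ψ i) (F.d j)).add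
      (md le_rfl (TestFunction.partialDeriv ψ i) F.fn j)).toLp _
  have ha : a =ᵐ[D.measure] _ := MemLp.coeFn_toLp _
  have hb : ∀ i, b i =ᵐ[D.measure] _ := fun i => MemLp.coeFn_toLp _
  have he : ∀ i j, e i j =ᵐ[D.measure] _ := fun i j => MemLp.coeFn_toLp _
  have he' : ∀ i j, e' i j =ᵐ[D.measure] _ := fun i j => MemLp.coeFn_toLp _
  have hF1 : ∀ i, IsWeakDeriv D i F.fn (F.d i) := F.2.1
  have hF2 : ∀ i j, IsWeakDeriv D j (F.d i) (F.dd i j) := F.2.2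
  let G : PiLp 2 (fun _ : JetIndex n => D.L2) := WithLp.toLp 2 (Sum.elim (fun _ => a)
    (Sum.elim b (fun p => e p.1 p.2 + e' p.1 p.2)))
  refine ⟨⟨G, fun i => (hF1 i).cutoff hΩ h12 ψ ha (hb i), fun i j => ?_⟩, ha, hb, fun i j => ?_⟩
  -- The first derivative is ψ∂_iF + (∂_iψ)F; the product rule applies again to each summand, with
  -- ∂_iψ as a cutoff that is only C¹.
  · let b1 : D.L2 := (m ψ (F.d i)).toLp _
    let b2 : D.L2 := (m (TestFunction.partialDeriv ψ i) F.fn).toLp _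
    have hb12 : b i = b1 + b2 := MemLp.toLp_add _ _
    change IsWeakDeriv D j (b i) (e i j + e' i j)
    rw [hb12]
    exact ((hF2 i j).cutoff hΩ h12 ψ (MemLp.coeFn_toLp _) (he i j)).add
      ((hF1 j).cutoff hΩ le_rfl (TestFunction.partialDeriv ψ i) (MemLp.coeFn_toLp _) (he' i j))
  · change (e i j + e' i j : D.L2) =ᵐ[D.measure] _
    filter_upwards [Lp.coeFn_add (e i j) (e' i j), he i j, he' i j] with x h1 h2 h3
    rw [h1, Pi.add_apply, h2, h3]
    rfl

theorem eLpNorm_measure_le (D : Density Ω) : ∃ K : ℝ≥0∞, K ≠ ∞ ∧ ∀ f : Eucl n → ℝ,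
    eLpNorm f 2 D.measure ≤ K * eLpNorm f 2 (volume.restrict (Ω : Set (Eucl n))) := by
  obtain ⟨K, hK⟩ := D.measure_le
  refine ⟨(K : ℝ≥0∞) ^ (1 / (2 : ℝ≥0∞).toReal), by simp, fun f => ?_⟩
  refine (eLpNorm_mono_measure f hK).trans (le_of_eq ?_)
  have : (K • volume.restrict (Ω : Set (Eucl n))) = (K : ℝ≥0∞) • volume.restrict (Ω : Set (Eucl n)) :=
    rfl
  rw [this, eLpNorm_smul_measure_of_ne_top (by simp), smul_eq_mul]
  simp

/-- The extension of ψF by zero lives on a compact subset of Ω, so its mollifications at small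
radius are test functions. Their derivatives are the mollifications of the weak derivatives, and
both converge in L². -/
theorem IsCutoffOf.zeroTrace (hΩ : Bornology.IsBounded (Ω : Set (Eucl n))) {ψ : 𝓓^{2}(Ω, ℝ)}
    {F G : H2 D} (h : IsCutoffOf ψ F G) : ZeroTrace G := by
  have hΩm : MeasurableSet (Ω : Set (Eucl n)) := Ω.isOpen.measurableSet
  have h12 : (1 : ℕ∞) ≤ 2 := by norm_num
  have hF1 : ∀ i, IsWeakDeriv D i F.fn (F.d i) := F.2.1
  obtain ⟨δ, hδ, hδΩ⟩ := ψ.hasCompactSupport.isCompact.exists_cthickening_subset_open Ω.isOpen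
    ψ.tsupport_subset
  set ρ : ℕ → ContDiffBump (0 : Eucl n) := bumpSeq (Eucl n) hδ
  have hρ : Tendsto (fun k => (ρ k).rOut) atTop (𝓝 0) := tendsto_bumpSeq_rOut hδ
  have hmeas : ∀ u : D.L2, Measurable u := fun u => (Lp.stronglyMeasurable u).measurable
  set g0 : Eucl n → ℝ := fun x => ψ x * F.fn x
  set g1 : Fin n → Eucl n → ℝ := fun i x => ψ x * F.d i x + fderiv ℝ ψ x (stdVec i) * F.fn x
  set F0 : Eucl n → ℝ := (Ω : Set (Eucl n)).indicator g0
  set F1 : Fin n → Eucl n → ℝ := fun i => (Ω : Set (Eucl n)).indicator (g1 i)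
  have mg0 : Measurable g0 := ψ.continuous.measurable.mul (hmeas _)
  have mg1 : ∀ i, Measurable (g1 i) := fun i => (ψ.continuous.measurable.mul (hmeas _)).add
    ((TestFunction.continuous_fderiv_apply h12 ψ _).measurable.mul (hmeas _))
  have lg0 : MemLp g0 2 (volume.restrict (Ω : Set (Eucl n))) :=
    memLp_continuous_mul (D.memLp_restrict _) ψ.continuous ψ.hasCompactSupport
  have lg1 : ∀ i, MemLp (g1 i) 2 (volume.restrict (Ω : Set (Eucl n))) := fun i =>
    (memLp_continuous_mul (D.memLp_restrict _) ψ.continuous ψ.hasCompactSupport).add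
      (memLp_continuous_mul (D.memLp_restrict _) (TestFunction.continuous_fderiv_apply h12 ψ _)
        (ψ.hasCompactSupport.fderiv_apply ℝ _))
  have l0 : MemLp F0 2 volume := (memLp_indicator_iff_restrict hΩm).2 lg0
  have l1 : ∀ i, MemLp (F1 i) 2 volume := fun i => (memLp_indicator_iff_restrict hΩm).2 (lg1 i)
  have loc0 : LocallyIntegrable F0 volume := l0.locallyIntegrable (by norm_num)
  have hsub : ∀ k, Function.support (mollify (ρ k) F0) ⊆ Metric.cthickening δ (tsupport ψ) := by
    intro k
    refine (support_mollify_subset _).trans ?_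
    refine (Metric.thickening_mono (bumpSeq_rOut_le hδ k) _).trans
      ((Metric.thickening_subset_cthickening _ _).trans
        (Metric.cthickening_subset_of_subset _ ?_))
    intro x hx
    have hx' : g0 x ≠ 0 := fun h0 => hx (by simp [F0, h0])
    exact subset_tsupport _ (left_ne_zero_of_mul hx')
  have hts : ∀ k, tsupport (mollify (ρ k) F0) ⊆ Metric.cthickening δ (tsupport ψ) := fun k =>
    closure_minimal (hsub k) Metric.isClosed_cthickening
  let Φ : ℕ → 𝓓(Ω, ℝ) := fun k => ⟨mollify (ρ k) F0, contDiff_mollify _ loc0,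
    HasCompactSupport.of_support_subset_isCompact ψ.hasCompactSupport.isCompact.cthickening
      (hsub k), (hts k).trans hδΩ⟩
  have hΦd : ∀ k i x, fderiv ℝ (Φ k) x (stdVec i) = mollify (ρ k) (F1 i) x := by
    intro k i x
    have e1 : fderiv ℝ (Φ k) x (stdVec i) = _ := fderiv_mollify_left (ρ k) loc0 x (stdVec i)
    have hd : ContDiff ℝ 1 ((ρ k).normed (volume : Measure (Eucl n))) :=
      (ρ k).contDiff_normed (n := 1)
    -- The reflected kernel need not be supported in Ω; the factor ψ provides the compact support.
    have e2 := (hF1 i).integral_cutoff hΩ h12 ψ (φ := fun t => (ρ k).normed volume (x - t))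
      (hd.comp (contDiff_const.sub contDiff_id))
    have e3 : ∀ t, fderiv ℝ (fun t => (ρ k).normed volume (x - t)) t (stdVec i)
        = - fderiv ℝ ((ρ k).normed volume) (x - t) (stdVec i) := by
      intro t
      have : HasFDerivAt (fun t => (ρ k).normed volume (x - t)) _ t :=
        ((hd.differentiable one_ne_zero) (x - t)).hasFDerivAt.comp t
          ((hasFDerivAt_const x t).sub (hasFDerivAt_id t))
      rw [this.fderiv]
      simp
    have e4 : ∀ (a g : Eucl n → ℝ), ∫ t, a t * (Ω : Set (Eucl n)).indicator g t
        = ∫ t in (Ω : Set (Eucl n)), g t * a t := by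
      intro a g
      rw [← integral_indicator hΩm]
      refine integral_congr_ae (Eventually.of_forall fun t => ?_)
      by_cases ht : t ∈ (Ω : Set (Eucl n)) <;> simp [ht, mul_comm]
    rw [e1, mollify_apply_swap, e4, e4]
    simp only [e3, mul_neg, integral_neg, neg_inj] at e2
    exact e2
  obtain ⟨K, hK, hKle⟩ := eLpNorm_measure_le D
  have hlim : ∀ {H : Eucl n → ℝ}, Measurable H → MemLp H 2 volume →
      Tendsto (fun k => K * eLpNorm (mollify (ρ k) H - H) 2 volume) atTop (𝓝 0) := by
    intro H h1 h2
    simpa using ENNReal.Tendsto.const_mul (tendsto_eLpNorm_mollify_sub hρ h1 h2) (Or.inr hK)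
  have hbd : ∀ {v : D.L2} {g : Eucl n → ℝ} (_ : v =ᵐ[D.measure] g) (m : Eucl n → ℝ),
      eLpNorm (fun x => v x - m x) 2 D.measure
        ≤ K * eLpNorm (m - (Ω : Set (Eucl n)).indicator g) 2 volume := by
    intro v g hv m
    have : eLpNorm (fun x => v x - m x) 2 D.measure
        = eLpNorm (m - (Ω : Set (Eucl n)).indicator g) 2 D.measure := by
      rw [eLpNorm_sub_comm]
      refine eLpNorm_congr_ae ?_
      filter_upwards [hv, D.ae_mem] with x hx hxΩ
      have : x ∈ (Ω : Set (Eucl n)) := hxΩ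
      simp [this, hx]
    rw [this]
    exact (hKle _).trans (mul_le_mul_right (eLpNorm_mono_measure _ Measure.restrict_le_self) _)
  refine ⟨Φ, ?_, fun i => ?_⟩
  · exact tendsto_of_tendsto_of_tendsto_of_le_of_le tendsto_const_nhds
      (hlim (mg0.indicator hΩm) l0) (fun _ => zero_le) fun k => hbd h.fn _
  · refine tendsto_of_tendsto_of_tendsto_of_le_of_le tendsto_const_nhds
      (hlim ((mg1 i).indicator hΩm) (l1 i)) (fun _ => zero_le) fun k => ?_
    simp only [hΦd]
    exact hbd (h.d i) _

end Cutoff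

/-! ### The cutoffs θ(η/ε) and their derivative bounds -/

section BoundaryCutoff

variable {n : ℕ} {Ω : TopologicalSpace.Opens (Eucl n)}

/-- A smooth step function, equal to `0` on `(-∞, 1]` and to `1` on `[2, ∞)`. -/
def smoothStep (t : ℝ) : ℝ := Real.smoothTransition (t - 1)

theorem contDiff_smoothStep {k : ℕ∞} : ContDiff ℝ k smoothStep :=
  Real.smoothTransition.contDiff.comp (contDiff_id.sub contDiff_const)

theorem smoothStep_of_le {t : ℝ} (h : t ≤ 1) : smoothStep t = 0 :=
  Real.smoothTransition.zero_of_nonpos (by linarith)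

theorem smoothStep_of_ge {t : ℝ} (h : 2 ≤ t) : smoothStep t = 1 :=
  Real.smoothTransition.one_of_one_le (by linarith)

theorem contDiff_deriv_smoothStep {k : ℕ} : ContDiff ℝ k (deriv smoothStep) :=
  (contDiff_succ_iff_deriv (n := k)).1 (contDiff_smoothStep (k := ((k + 1 : ℕ) : ℕ∞))) |>.2.2

theorem hasCompactSupport_deriv_smoothStep : HasCompactSupport (deriv smoothStep) := by
  refine HasCompactSupport.of_support_subset_isCompact (isCompact_Icc (a := (1 : ℝ)) (b := 2)) ?_
  intro t ht
  by_contra hn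
  refine ht ?_
  rw [Set.mem_Icc, not_and_or, not_le, not_le] at hn
  rcases hn with h | h
  · have : smoothStep =ᶠ[𝓝 t] fun _ => 0 := by
      filter_upwards [Iio_mem_nhds h] with s hs using smoothStep_of_le (le_of_lt hs)
    rw [this.deriv_eq, deriv_const]
  · have : smoothStep =ᶠ[𝓝 t] fun _ => 1 := by
      filter_upwards [Ioi_mem_nhds h] with s hs using smoothStep_of_ge (le_of_lt hs)
    rw [this.deriv_eq, deriv_const]

theorem exists_bound_deriv_smoothStep : ∃ C : ℝ, 0 ≤ C ∧
    (∀ t, |deriv smoothStep t| ≤ C) ∧ ∀ t, |deriv (deriv smoothStep) t| ≤ C := by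
  obtain ⟨A, hA⟩ := (contDiff_deriv_smoothStep (k := 0)).continuous.bounded_above_of_compact_support
    hasCompactSupport_deriv_smoothStep
  obtain ⟨B, hB⟩ := ((contDiff_deriv_smoothStep (k := 1)).continuous_deriv
    (by norm_num)).bounded_above_of_compact_support hasCompactSupport_deriv_smoothStep.deriv
  exact ⟨max A B, (norm_nonneg _).trans ((hA 0).trans (le_max_left _ _)),
    fun t => (hA t).trans (le_max_left _ _), fun t => (hB t).trans (le_max_right _ _)⟩

/-- The function `x ↦ θ(η(x)/ε)` on `Ω`, extended by zero. -/
def boundaryCutoffFun (Ω : TopologicalSpace.Opens (Eucl n)) (η : Eucl n → ℝ) (ε : ℝ) :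
    Eucl n → ℝ :=
  (Ω : Set (Eucl n)).indicator fun x => smoothStep (η x / ε)

variable {η : Eucl n → ℝ}

/-- The superlevel set of `η` in the closure of `Ω`. -/
def superlevel (Ω : TopologicalSpace.Opens (Eucl n)) (η : Eucl n → ℝ) (ε : ℝ) : Set (Eucl n) :=
  closure (Ω : Set (Eucl n)) ∩ {x | ε ≤ η x}

theorem IsAuxiliary.contDiff (hη : IsAuxiliary (Ω : Set (Eucl n)) η) : ContDiff ℝ 3 η := hη.ckb.1

theorem isCompact_superlevel (hΩ : Bornology.IsBounded (Ω : Set (Eucl n)))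
    (hη : IsAuxiliary (Ω : Set (Eucl n)) η) (ε : ℝ) : IsCompact (superlevel Ω η ε) :=
  hΩ.isCompact_closure.inter_right (isClosed_le continuous_const hη.contDiff.continuous)

/-- A point of the closure outside Ω is a boundary point, where η = 0 < ε. Intersecting with the
closure of Ω is essential, as η may be large away from Ω. -/
theorem superlevel_subset (hη : IsAuxiliary (Ω : Set (Eucl n)) η) {ε : ℝ} (hε : 0 < ε) :
    superlevel Ω η ε ⊆ Ω := by
  rintro x ⟨hx, hxε⟩
  by_contra h
  have : x ∈ frontier (Ω : Set (Eucl n)) := by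
    rw [Ω.isOpen.frontier_eq]; exact ⟨hx, h⟩
  have h0 := hη.eq_zero x this
  have : ε ≤ η x := hxε
  linarith

theorem support_boundaryCutoffFun_subset {ε : ℝ} (hε : 0 < ε) :
    Function.support (boundaryCutoffFun Ω η ε) ⊆ superlevel Ω η ε := by
  intro x hx
  have hxΩ : x ∈ (Ω : Set (Eucl n)) := Set.mem_of_indicator_ne_zero hx
  refine ⟨subset_closure hxΩ, ?_⟩
  by_contra h
  refine hx ?_
  rw [boundaryCutoffFun, Set.indicator_of_mem hxΩ]
  refine smoothStep_of_le ?_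
  rw [div_le_one hε]
  exact (not_le.1 h).le

theorem boundaryCutoffFun_eventuallyEq {ε : ℝ} {x : Eucl n} (hx : x ∈ Ω) :
    boundaryCutoffFun Ω η ε =ᶠ[𝓝 x] fun y => smoothStep (η y / ε) := by
  filter_upwards [Ω.isOpen.mem_nhds hx] with y hy
  rw [boundaryCutoffFun, Set.indicator_of_mem hy]

/-- The cutoff `θ(η/ε)` as a compactly supported `C²` function in `Ω`. -/
def boundaryCutoff (hΩ : Bornology.IsBounded (Ω : Set (Eucl n)))
    (hη : IsAuxiliary (Ω : Set (Eucl n)) η) {ε : ℝ} (hε : 0 < ε) : 𝓓^{2}(Ω, ℝ) where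
  toFun := boundaryCutoffFun Ω η ε
  contDiff' := by
    rw [contDiff_iff_contDiffAt]
    intro x
    -- On the superlevel set the formula θ(η/ε) holds nearby, as the set lies in Ω; off this closed
    -- set the function is locally zero.
    by_cases hx : x ∈ superlevel Ω η ε
    · refine ContDiffAt.congr_of_eventuallyEq ?_
        (boundaryCutoffFun_eventuallyEq (superlevel_subset hη hε hx))
      exact (contDiff_smoothStep.comp
        ((hη.contDiff.of_le (by norm_num)).div_const ε)).contDiffAt
    · refine (contDiffAt_const (c := (0 : ℝ))).congr_of_eventuallyEq ?_
      filter_upwards [(isCompact_superlevel hΩ hη ε).isClosed.isOpen_compl.mem_nhds hx] with y hy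
      by_contra h
      exact hy (support_boundaryCutoffFun_subset hε h)
  hasCompactSupport' := HasCompactSupport.of_support_subset_isCompact
    (isCompact_superlevel hΩ hη ε) (support_boundaryCutoffFun_subset hε)
  tsupport_subset' := (closure_minimal (support_boundaryCutoffFun_subset hε)
    (isCompact_superlevel hΩ hη ε).isClosed).trans (superlevel_subset hη hε)

section

variable (hΩ : Bornology.IsBounded (Ω : Set (Eucl n))) (hη : IsAuxiliary (Ω : Set (Eucl n)) η)
  {ε : ℝ} (hε : 0 < ε) {x : Eucl n}

theorem boundaryCutoff_apply (hx : x ∈ Ω) :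
    boundaryCutoff hΩ hη hε x = smoothStep (η x / ε) :=
  (boundaryCutoffFun_eventuallyEq (η := η) (ε := ε) hx).eq_of_nhds

theorem abs_boundaryCutoff_le : |boundaryCutoff hΩ hη hε x| ≤ 1 := by
  change |boundaryCutoffFun Ω η ε x| ≤ 1
  by_cases hx : x ∈ (Ω : Set (Eucl n))
  · rw [boundaryCutoffFun, Set.indicator_of_mem hx, smoothStep,
      abs_of_nonneg (Real.smoothTransition.nonneg _)]
    exact Real.smoothTransition.le_one _
  · simp [boundaryCutoffFun, hx]

theorem boundaryCutoff_eq_zero (hx : x ∈ Ω) (h : η x ≤ ε) : boundaryCutoff hΩ hη hε x = 0 := by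
  rw [boundaryCutoff_apply hΩ hη hε hx]
  exact smoothStep_of_le ((div_le_one hε).2 h)

theorem boundaryCutoff_eventuallyEq_one (hx : x ∈ Ω) (h : 2 * ε < η x) :
    boundaryCutoff hΩ hη hε =ᶠ[𝓝 x] fun _ => 1 := by
  filter_upwards [Ω.isOpen.mem_nhds hx,
    hη.contDiff.continuous.continuousAt.eventually (lt_mem_nhds h)] with y hy hy2
  rw [boundaryCutoff_apply hΩ hη hε hy]
  exact smoothStep_of_ge ((le_div_iff₀ hε).2 hy2.le)

theorem fderiv_boundaryCutoff_eventuallyEq_zero (hx : x ∈ Ω) (h : 2 * ε < η x) (v : Eucl n) :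
    (fun y => fderiv ℝ (boundaryCutoff hΩ hη hε) y v) =ᶠ[𝓝 x] fun _ => 0 := by
  filter_upwards [(boundaryCutoff_eventuallyEq_one hΩ hη hε hx h).fderiv (𝕜 := ℝ)] with y hy
  rw [hy]; simp

theorem fderiv_boundaryCutoff (hx : x ∈ Ω) (v : Eucl n) :
    fderiv ℝ (boundaryCutoff hΩ hη hε) x v
      = deriv smoothStep (η x / ε) * (fderiv ℝ η x v / ε) := by
  have h1 : (boundaryCutoff hΩ hη hε : Eucl n → ℝ) =ᶠ[𝓝 x] fun y => smoothStep (η y / ε) :=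
    boundaryCutoffFun_eventuallyEq hx
  have hd : HasFDerivAt (fun y => η y / ε) (ε⁻¹ • fderiv ℝ η x) x := by
    have := ((hη.contDiff.differentiable (by norm_num)) x).hasFDerivAt.const_mul ε⁻¹
    simpa [div_eq_inv_mul] using this
  have hs := (((contDiff_smoothStep (k := 1)).differentiable
    (by norm_num)) (η x / ε)).hasDerivAt.comp_hasFDerivAt x hd
  have hs' : HasFDerivAt (fun y => smoothStep (η y / ε)) _ x := hs
  rw [h1.fderiv_eq, hs'.fderiv]
  simp [div_eq_inv_mul]

theorem fderiv_fderiv_boundaryCutoff (hx : x ∈ Ω) (v z : Eucl n) :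
    fderiv ℝ (fun y => fderiv ℝ (boundaryCutoff hΩ hη hε) y v) x z
      = deriv (deriv smoothStep) (η x / ε) * (fderiv ℝ η x z / ε) * (fderiv ℝ η x v / ε)
        + deriv smoothStep (η x / ε) * (fderiv ℝ (fderiv ℝ η) x z v / ε) := by
  have h1 : (fun y => fderiv ℝ (boundaryCutoff hΩ hη hε) y v) =ᶠ[𝓝 x]
      fun y => deriv smoothStep (η y / ε) * (fderiv ℝ η y v / ε) := by
    filter_upwards [Ω.isOpen.mem_nhds hx] with y hy using fderiv_boundaryCutoff hΩ hη hε hy v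
  have hd : HasFDerivAt (fun y => η y / ε) (ε⁻¹ • fderiv ℝ η x) x := by
    have := ((hη.contDiff.differentiable (by norm_num)) x).hasFDerivAt.const_mul ε⁻¹
    simpa [div_eq_inv_mul] using this
  have hs₀ := (((contDiff_deriv_smoothStep (k := 1)).differentiable
      (by norm_num)) (η x / ε)).hasDerivAt.comp_hasFDerivAt x hd
  have hs : HasFDerivAt (fun y => deriv smoothStep (η y / ε)) _ x := hs₀
  have hf : HasFDerivAt (fderiv ℝ η) (fderiv ℝ (fderiv ℝ η) x) x :=
    ((hη.contDiff.fderiv_right (m := 2) (by norm_num)).differentiable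
      (by norm_num) x).hasFDerivAt
  have hf' : HasFDerivAt (fun y => fderiv ℝ η y v / ε)
      (ε⁻¹ • (fderiv ℝ (fderiv ℝ η) x).flip v) x := by
    have := (hf.clm_apply (hasFDerivAt_const v x)).const_mul ε⁻¹
    simpa [div_eq_inv_mul] using this
  have hm := HasFDerivAt.fun_mul (𝕜 := ℝ) hs hf'
  rw [h1.fderiv_eq, hm.fderiv]
  simp [div_eq_inv_mul]
  ring

end

/-- Each derivative of θ(η/ε) costs a factor 1/ε. The condition ε ≤ 1 absorbs the 1/ε term, coming
from the second derivative of η, into 1/ε². -/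
theorem exists_bound_boundaryCutoff (hΩ : Bornology.IsBounded (Ω : Set (Eucl n)))
    (hη : IsAuxiliary (Ω : Set (Eucl n)) η) : ∃ C : ℝ, 0 ≤ C ∧
      ∀ {ε : ℝ} (hε : 0 < ε), ε ≤ 1 → ∀ x ∈ Ω, ∀ i j : Fin n,
        |fderiv ℝ (boundaryCutoff hΩ hη hε) x (stdVec i)| ≤ C / ε ∧
        |fderiv ℝ (TestFunction.partialDeriv (boundaryCutoff hΩ hη hε) i) x (stdVec j)|
          ≤ C / ε ^ 2 := by
  obtain ⟨A, hA0, hA1, hA2⟩ := exists_bound_deriv_smoothStep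
  obtain ⟨B1, hB1⟩ := hη.ckb.2 1 (by norm_num)
  obtain ⟨B2, hB2⟩ := hη.ckb.2 2 (by norm_num)
  have hB1' : ∀ x, ‖fderiv ℝ η x‖ ≤ B1 := fun x => by
    rw [← norm_iteratedFDeriv_one]; exact hB1 x
  have hB2' : ∀ x, ‖fderiv ℝ (fderiv ℝ η) x‖ ≤ B2 := fun x => by
    rw [← norm_iteratedFDeriv_one, norm_iteratedFDeriv_fderiv]; exact hB2 x
  have hb1 : 0 ≤ B1 := (norm_nonneg _).trans (hB1' 0)
  have hb2 : 0 ≤ B2 := le_trans (norm_nonneg (fderiv ℝ (fderiv ℝ η) 0)) (hB2' 0)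
  have e1 : ∀ x i, |fderiv ℝ η x (stdVec i)| ≤ B1 := fun x i => by
    refine ((fderiv ℝ η x).le_opNorm (stdVec i)).trans ?_
    simpa using hB1' x
  have e2 : ∀ x i j, |fderiv ℝ (fderiv ℝ η) x (stdVec j) (stdVec i)| ≤ B2 := fun x i j => by
    refine ((fderiv ℝ (fderiv ℝ η) x).le_opNorm₂ (stdVec j) (stdVec i)).trans ?_
    simpa using hB2' x
  refine ⟨A * B1 + A * B1 * B1 + A * B2, by positivity, fun {ε} hε hε1 x hx i j => ⟨?_, ?_⟩⟩
  · rw [fderiv_boundaryCutoff hΩ hη hε hx, abs_mul, abs_div, abs_of_pos hε, mul_div_assoc']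
    refine div_le_div_of_nonneg_right ?_ hε.le
    have := mul_le_mul (hA1 (η x / ε)) (e1 x i) (abs_nonneg _) hA0
    have : 0 ≤ A * B1 * B1 + A * B2 := by positivity
    linarith
  · rw [show (TestFunction.partialDeriv (boundaryCutoff hΩ hη hε) i : Eucl n → ℝ)
      = fun y => fderiv ℝ (boundaryCutoff hΩ hη hε) y (stdVec i) from rfl,
      fderiv_fderiv_boundaryCutoff hΩ hη hε hx]
    refine (abs_add_le _ _).trans ?_
    simp only [abs_mul, abs_div, abs_of_pos hε]
    have m1 := mul_le_mul (mul_le_mul (hA2 (η x / ε)) (e1 x j) (abs_nonneg _) hA0) (e1 x i)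
      (abs_nonneg _) (by positivity)
    have m2 := mul_le_mul (hA1 (η x / ε)) (e2 x i j) (abs_nonneg _) hA0
    have m3 : |deriv smoothStep (η x / ε)| * |fderiv ℝ (fderiv ℝ η) x (stdVec j) (stdVec i)| * ε
        ≤ A * B2 := (mul_le_of_le_one_right (by positivity) hε1).trans m2
    have : 0 ≤ A * B1 := by positivity
    rw [le_div_iff₀ (by positivity)]
    field_simp
    linarith

end BoundaryCutoff

/-! ### Locality of the operator and monotonicity at arbitrary base points -/

section Monotonicity

variable {n : ℕ} {Ω : TopologicalSpace.Opens (Eucl n)} {D : Density Ω}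

/-- The size of the second-order jet of `F` at `x`. -/
def jetSize (F : H2 D) (x : Eucl n) : ℝ :=
  |F.fn x| + ∑ i, |F.d i x| + 1 / 2 * ∑ i, ∑ j, |F.dd i j x|

theorem H2.sub_ae (F G : H2 D) : ∀ᵐ x ∂D.measure,
    (F - G).fn x = F.fn x - G.fn x ∧ (∀ i, (F - G).d i x = F.d i x - G.d i x) ∧
      ∀ i j, (F - G).dd i j x = F.dd i j x - G.dd i j x := by
  have h0 : ∀ᵐ x ∂D.measure, (F - G).fn x = F.fn x - G.fn x := Lp.coeFn_sub F.fn G.fn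
  have h1 : ∀ i, ∀ᵐ x ∂D.measure, (F - G).d i x = F.d i x - G.d i x := fun i =>
    Lp.coeFn_sub (F.d i) (G.d i)
  have h2 : ∀ i j, ∀ᵐ x ∂D.measure, (F - G).dd i j x = F.dd i j x - G.dd i j x := fun i j =>
    Lp.coeFn_sub (F.dd i j) (G.dd i j)
  filter_upwards [h0, ae_all_iff.2 h1, ae_all_iff.2 fun i => ae_all_iff.2 (h2 i)] with x a b c
    using ⟨a, b, c⟩

theorem PointwiseLipschitz.exists_bound {L : H2 D → D.L2} (hL : PointwiseLipschitz L) :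
    ∃ C : ℝ, 0 ≤ C ∧ ∀ F G : H2 D, ∀ᵐ x ∂D.measure,
      |L F x - L G x| ≤ C * jetSize (F - G) x := by
  obtain ⟨C, hC⟩ := hL
  refine ⟨|C|, abs_nonneg _, fun F G => ?_⟩
  filter_upwards [hC F G, H2.sub_ae F G] with x h1 ⟨h2, h3, h4⟩
  refine h1.trans ?_
  simp only [jetSize, h2, h3, h4]
  gcongr
  exact le_abs_self C

theorem memLp_jetSize (F : H2 D) : MemLp (jetSize F) 2 D.measure :=
  ((Lp.memLp F.fn).abs.add (memLp_finsetSum _ fun i _ => (Lp.memLp (F.d i)).abs)).add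
    ((memLp_finsetSum _ fun i _ => memLp_finsetSum _ fun j _ =>
      (Lp.memLp (F.dd i j)).abs).const_mul _)

/-- The operator is local: it commutes with cutoffs where the cutoff is locally constant. -/
theorem IsCutoffOf.ae_eq {L : H2 D → D.L2} (hL : PointwiseLipschitz L) {ψ : 𝓓^{2}(Ω, ℝ)}
    {F G : H2 D} (h : IsCutoffOf ψ F G) : ∀ᵐ x ∂D.measure, (ψ =ᶠ[𝓝 x] fun _ => 1) →
      G.fn x = F.fn x ∧ L G x = L F x := by
  obtain ⟨C, -, hC⟩ := hL.exists_bound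
  filter_upwards [hC G F, H2.sub_ae G F, h.fn, ae_all_iff.2 h.d,
    ae_all_iff.2 fun i => ae_all_iff.2 (h.dd i)] with x h1 ⟨h2, h3, h4⟩ h5 h6 h7 hψ
  have a0 : ψ x = 1 := hψ.eq_of_nhds
  have a1 : ∀ v, fderiv ℝ ψ x v = 0 := fun v => by rw [hψ.fderiv_eq]; simp
  have a2 : ∀ i v, fderiv ℝ (TestFunction.partialDeriv ψ i) x v = 0 := fun i v => by
    have : (TestFunction.partialDeriv ψ i : Eucl n → ℝ) =ᶠ[𝓝 x] fun _ => 0 := by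
      filter_upwards [hψ.fderiv (𝕜 := ℝ)] with y hy
      rw [TestFunction.partialDeriv_apply, hy]; simp
    rw [this.fderiv_eq]; simp
  have hz : jetSize (G - F) x = 0 := by
    simp [jetSize, h2, h3, h4, h5, h6, h7, a0, a1, a2]
  rw [hz, mul_zero] at h1
  exact ⟨by rw [h5, a0, one_mul], by simpa [sub_eq_zero] using h1⟩

theorem inner_eq_integral {μ : Measure (Eucl n)} (u v : Lp ℝ 2 μ) :
    ⟪u, v⟫_ℝ = ∫ x, u x * v x ∂μ := by
  rw [L2.inner_def]
  refine integral_congr_ae (Eventually.of_forall fun x => ?_)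
  simp [mul_comm]

/-- Strong monotonicity, transferred to increments that vanish on the boundary to first order
at an arbitrary base point of `H²`. -/
theorem inner_le_of_abs_le (hΩ : Bornology.IsBounded (Ω : Set (Eucl n)))
    {η : Eucl n → ℝ} (hη : IsAuxiliary (Ω : Set (Eucl n)) η) {L : H2 D → D.L2}
    (hL : PointwiseLipschitz L) {γ : ℝ}
    (hmono : ∀ f₁ f₂ : H2 D, ZeroTrace f₁ → ZeroTrace f₂ →
      ⟪f₁.fn - f₂.fn, L f₁ - L f₂⟫_ℝ ≤ -γ * ‖f₁.fn - f₂.fn‖ ^ 2)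
    (g h : H2 D) {K : ℝ} (hK : ∀ᵐ x ∂D.measure, |h.fn x| ≤ K * η x) :
    ⟪h.fn, L (g + h) - L g⟫_ℝ ≤ -γ * ‖h.fn‖ ^ 2 := by
  have := D.isFiniteMeasure hΩ
  obtain ⟨C, hC0, hC⟩ := hL.exists_bound
  obtain ⟨A, hA0, hA⟩ := exists_bound_boundaryCutoff hΩ hη
  set ε : ℕ → ℝ := fun k => 1 / ((k : ℝ) + 1)
  have hε : ∀ k, 0 < ε k := fun k => by positivity
  have hε1 : ∀ k, ε k ≤ 1 := fun k => div_le_one_of_le₀ (by simp) (by positivity)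
  have hε4 : ∀ k, 0 < ε k / 4 := fun k => div_pos (hε k) (by norm_num)
  set χ : ℕ → 𝓓^{2}(Ω, ℝ) := fun k => boundaryCutoff hΩ hη (hε k)
  set ζ : ℕ → 𝓓^{2}(Ω, ℝ) := fun k => boundaryCutoff hΩ hη (hε4 k)
  choose H hH using fun k => exists_isCutoffOf hΩ (χ k) h
  -- At level ε/4 the cutoff ζ is 1 on η > ε/2, hence near every point where χ ≠ 0. So ζ(g + χh) and
  -- ζg have zero trace, differ by χh, and by locality have the same image under 𝓛 as g + χh and g
  -- wherever χh ≠ 0.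
  choose f₁ hf₁ using fun k => exists_isCutoffOf hΩ (ζ k) (g + H k)
  choose f₂ hf₂ using fun k => exists_isCutoffOf hΩ (ζ k) g
  set Φ : ℕ → Eucl n → ℝ := fun k x =>
    (H k).fn x * (L (g + H k) x - L g x) + γ * ((H k).fn x * (H k).fn x)
  set Φ₀ : Eucl n → ℝ := fun x => h.fn x * (L (g + h) x - L g x) + γ * (h.fn x * h.fn x)
  have hadd : ∀ F : H2 D, ∀ᵐ x ∂D.measure, (g + F).fn x = g.fn x + F.fn x := fun F =>
    Lp.coeFn_add g.fn F.fn
  -- the integral of `Φ k` is nonpositive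
  have hint : ∀ (F G : H2 D) (f : D.L2), ∫ x, f x * (L F x - L G x) + γ * (f x * f x) ∂D.measure
      = ⟪f, L F - L G⟫_ℝ + γ * ‖f‖ ^ 2 := by
    intro F G f
    rw [← real_inner_self_eq_norm_sq, inner_eq_integral, inner_eq_integral, ← integral_const_mul,
      ← integral_add]
    · refine integral_congr_ae ?_
      filter_upwards [Lp.coeFn_sub (L F) (L G)] with x hx
      rw [hx, Pi.sub_apply]
    · exact (Lp.memLp f).integrable_mul (Lp.memLp (L F - L G))
    · exact ((Lp.memLp f).integrable_mul (Lp.memLp f)).const_mul γ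
  have hneg : ∀ k, ∫ x, Φ k x ∂D.measure ≤ 0 := by
    intro k
    have h1 := hmono (f₁ k) (f₂ k) ((hf₁ k).zeroTrace hΩ) ((hf₂ k).zeroTrace hΩ)
    have h2 : ∫ x, Φ k x ∂D.measure
        = ∫ x, ((f₁ k).fn - (f₂ k).fn : D.L2) x * (L (f₁ k) x - L (f₂ k) x)
          + γ * (((f₁ k).fn - (f₂ k).fn : D.L2) x * ((f₁ k).fn - (f₂ k).fn : D.L2) x)
            ∂D.measure := by
      refine integral_congr_ae ?_
      filter_upwards [(hf₁ k).ae_eq hL, (hf₂ k).ae_eq hL, (hH k).fn, (hf₁ k).fn, (hf₂ k).fn,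
        Lp.coeFn_sub (f₁ k).fn (f₂ k).fn, hadd (H k), D.ae_mem] with x a1 a2 a3 a4 a5 a6 a7 hx
      simp only [Φ]
      rw [a6, Pi.sub_apply]
      by_cases hη1 : η x ≤ ε k
      · have : χ k x = 0 := boundaryCutoff_eq_zero hΩ hη (hε k) hx hη1
        have hH0 : (H k).fn x = 0 := by rw [a3, this, zero_mul]
        have : (f₁ k).fn x - (f₂ k).fn x = 0 := by rw [a4, a5, a7, hH0]; ring
        rw [this, hH0]; ring
      · have hζ := boundaryCutoff_eventuallyEq_one hΩ hη (hε4 k) hx (by linarith [hε k])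
        rw [(a1 hζ).1, (a1 hζ).2, (a2 hζ).1, (a2 hζ).2, a7]
        ring
    rw [h2, hint]
    linarith
  -- domination
  have hK' : ∀ᵐ x ∂D.measure, |h.fn x| ≤ |K| * η x := by
    filter_upwards [hK, D.ae_mem] with x hx hxΩ
    exact hx.trans (mul_le_mul_of_nonneg_right (le_abs_self K) (hη.mem_Ioo x hxΩ).1.le)
  -- Where η ≤ 2ε, |h| ≤ 2|K|ε, while the cutoff derivatives are at most A/ε and A/ε². Thus M bounds
  -- |h||∂χ| and M' bounds |h|²|∂∂χ|, uniformly in ε.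
  set M : ℝ := 2 * |K| * A
  set M' : ℝ := 4 * |K| ^ 2 * A
  set J : Eucl n → ℝ := fun x => C * (|h.fn x| * jetSize h x + (∑ _i : Fin n, M * |h.fn x|
    + 1 / 2 * ∑ i, ∑ j, (M * |h.d i x| + (M * |h.d j x| + M')))) + |γ| * (|h.fn x| * |h.fn x|)
  have hiabs : ∀ u : D.L2, Integrable (fun x => |u x|) D.measure := fun u =>
    ((Lp.memLp u).integrable (by norm_num)).abs
  have hJ : Integrable J D.measure := by
    refine Integrable.add (Integrable.const_mul (Integrable.add ?_ (Integrable.add ?_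
      (Integrable.const_mul ?_ _))) _) (Integrable.const_mul ?_ _)
    · exact (Lp.memLp h.fn).abs.integrable_mul (memLp_jetSize h)
    · exact integrable_finsetSum _ fun i _ => (hiabs _).const_mul _
    · exact integrable_finsetSum _ fun i _ => integrable_finsetSum _ fun j _ =>
        ((hiabs _).const_mul _).add (((hiabs _).const_mul _).add (integrable_const _))
    · exact (Lp.memLp h.fn).abs.integrable_mul (Lp.memLp h.fn).abs
  have hbound : ∀ k, ∀ᵐ x ∂D.measure, ‖Φ k x‖ ≤ J x := by
    intro k
    filter_upwards [(hH k).fn, ae_all_iff.2 (hH k).d,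
      ae_all_iff.2 fun i => ae_all_iff.2 ((hH k).dd i), hC (g + H k) g, hK', D.ae_mem]
      with x a0 a1 a2 a3 a4 hx
    rw [add_sub_cancel_left] at a3
    have hχ : |χ k x| ≤ 1 := abs_boundaryCutoff_le hΩ hη (hε k)
    set p := |h.fn x|
    have hp : 0 ≤ p := abs_nonneg _
    have hsum0 : 0 ≤ ∑ _i : Fin n, M * p := Finset.sum_nonneg fun i _ => by positivity
    have hsum1 : 0 ≤ ∑ i, ∑ j, (M * |h.d i x| + (M * |h.d j x| + M')) :=
      Finset.sum_nonneg fun i _ => Finset.sum_nonneg fun j _ => by positivity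
    have hpH : |(H k).fn x| ≤ p := by
      rw [a0, abs_mul]; exact mul_le_of_le_one_left hp hχ
    have hkey : |(H k).fn x| * jetSize (H k) x ≤ p * jetSize h x + (∑ _i : Fin n, M * p
        + 1 / 2 * ∑ i, ∑ j, (M * |h.d i x| + (M * |h.d j x| + M'))) := by
      -- Beyond 2ε the cutoff is locally 1 and the jets coincide. In the remaining layer the
      -- undifferentiated factor |h| compensates the derivatives of the cutoff.
      by_cases hη2 : 2 * ε k < η x
      · have hψ := boundaryCutoff_eventuallyEq_one hΩ hη (hε k) hx hη2
        have b0 : χ k x = 1 := hψ.eq_of_nhds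
        have b1 : ∀ v, fderiv ℝ (χ k) x v = 0 := fun v => by rw [hψ.fderiv_eq]; simp
        have b2 : ∀ i v, fderiv ℝ (TestFunction.partialDeriv (χ k) i) x v = 0 := fun i v => by
          have : (TestFunction.partialDeriv (χ k) i : Eucl n → ℝ) =ᶠ[𝓝 x] fun _ => 0 :=
            fderiv_boundaryCutoff_eventuallyEq_zero hΩ hη (hε k) hx hη2 _
          rw [this.fderiv_eq]; simp
        have : jetSize (H k) x = jetSize h x := by
          simp [jetSize, a0, a1, a2, b0, b1, b2]
        have hj : 0 ≤ jetSize h x := by unfold jetSize; positivity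
        rw [this]
        have := mul_le_mul_of_nonneg_right hpH hj
        linarith
      · have hpε : p ≤ 2 * |K| * ε k := by
          have := mul_le_mul_of_nonneg_left (not_lt.1 hη2) (abs_nonneg K)
          linarith
        have hε0 := hε k
        have c1 : ∀ i, p * |fderiv ℝ (χ k) x (stdVec i)| ≤ M := fun i => by
          have h1 := (hA (hε k) (hε1 k) x hx i i).1
          calc _ ≤ 2 * |K| * ε k * (A / ε k) := mul_le_mul hpε h1 (abs_nonneg _) (by positivity)
            _ = M := by simp only [M]; field_simp
        have c2 : ∀ i j, p * (p * |fderiv ℝ (TestFunction.partialDeriv (χ k) i) x (stdVec j)|)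
            ≤ M' := fun i j => by
          have h1 := (hA (hε k) (hε1 k) x hx i j).2
          calc _ ≤ 2 * |K| * ε k * (2 * |K| * ε k * (A / ε k ^ 2)) :=
                mul_le_mul hpε (mul_le_mul hpε h1 (abs_nonneg _) (by positivity))
                  (by positivity) (by positivity)
            _ = M' := by simp only [M']; field_simp; norm_num; ring
        have d0 : p * |(H k).fn x| ≤ p * p := mul_le_mul_of_nonneg_left hpH hp
        have d1 : ∀ i, p * |(H k).d i x| ≤ p * |h.d i x| + M * p := fun i => by
          rw [a1]
          have h1 : |χ k x * h.d i x| ≤ |h.d i x| := by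
            rw [abs_mul]; exact mul_le_of_le_one_left (abs_nonneg _) hχ
          have h2 := mul_le_mul_of_nonneg_right (c1 i) hp
          have h3 := mul_le_mul_of_nonneg_left ((abs_add_le (χ k x * h.d i x)
            (fderiv ℝ (χ k) x (stdVec i) * h.fn x)).trans (add_le_add_left h1 _)) hp
          rw [abs_mul] at h3
          refine h3.trans ?_
          rw [mul_add]
          linarith
        have d2 : ∀ i j, p * |(H k).dd i j x|
            ≤ p * |h.dd i j x| + (M * |h.d i x| + (M * |h.d j x| + M')) := fun i j => by
          rw [a2]
          have h1 : |χ k x * h.dd i j x| ≤ |h.dd i j x| := by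
            rw [abs_mul]; exact mul_le_of_le_one_left (abs_nonneg _) hχ
          have h2 := mul_le_mul_of_nonneg_right (c1 j) (abs_nonneg (h.d i x))
          have h3 := mul_le_mul_of_nonneg_right (c1 i) (abs_nonneg (h.d j x))
          have h4 := c2 i j
          have h5 := mul_le_mul_of_nonneg_left ((abs_add_le (χ k x * h.dd i j x
              + fderiv ℝ (χ k) x (stdVec j) * h.d i x) (fderiv ℝ (χ k) x (stdVec i) * h.d j x
              + fderiv ℝ (TestFunction.partialDeriv (χ k) i) x (stdVec j) * h.fn x)).trans
            (add_le_add ((abs_add_le _ _).trans (add_le_add_left h1 _)) (abs_add_le _ _))) hp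
          simp only [abs_mul] at h5
          refine h5.trans ?_
          rw [mul_add, mul_add, mul_add]
          linarith
        have hHj : 0 ≤ jetSize (H k) x := by unfold jetSize; positivity
        refine (mul_le_mul_of_nonneg_right hpH hHj).trans ?_
        have e1 : p * ∑ i, |(H k).d i x| ≤ p * (∑ i, |h.d i x|) + ∑ _i : Fin n, M * p := by
          rw [Finset.mul_sum, Finset.mul_sum, ← Finset.sum_add_distrib]
          exact Finset.sum_le_sum fun i _ => d1 i
        have e2 : p * ∑ i, ∑ j, |(H k).dd i j x| ≤ p * (∑ i, ∑ j, |h.dd i j x|)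
            + ∑ i, ∑ j, (M * |h.d i x| + (M * |h.d j x| + M')) := by
          simp only [Finset.mul_sum]
          rw [← Finset.sum_add_distrib]
          refine Finset.sum_le_sum fun i _ => ?_
          rw [← Finset.sum_add_distrib]
          exact Finset.sum_le_sum fun j _ => d2 i j
        simp only [jetSize]
        rw [mul_add, mul_add, mul_add, mul_add]
        linarith
    rw [Real.norm_eq_abs]
    refine (abs_add_le _ _).trans (add_le_add ?_ ?_)
    · rw [abs_mul]
      calc _ ≤ |(H k).fn x| * (C * jetSize (H k) x) :=
            mul_le_mul_of_nonneg_left a3 (abs_nonneg _)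
        _ = C * (|(H k).fn x| * jetSize (H k) x) := by ring
        _ ≤ _ := mul_le_mul_of_nonneg_left hkey hC0
    · rw [abs_mul, abs_mul]
      exact mul_le_mul_of_nonneg_left (mul_le_mul hpH hpH (abs_nonneg _) hp) (abs_nonneg _)
  -- pointwise convergence
  have hlim : ∀ᵐ x ∂D.measure, Tendsto (fun k => Φ k x) atTop (𝓝 (Φ₀ x)) := by
    have hae : ∀ k, ∀ᵐ x ∂D.measure, 2 * ε k < η x → Φ k x = Φ₀ x := by
      intro k
      filter_upwards [(hH k).fn, ae_all_iff.2 (hH k).d,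
        ae_all_iff.2 fun i => ae_all_iff.2 ((hH k).dd i), hC (g + H k) (g + h),
        H2.sub_ae (H k) h, D.ae_mem] with x a0 a1 a2 a3 ⟨b0, b1, b2⟩ hx hη2
      rw [add_sub_add_left_eq_sub] at a3
      have hψ := boundaryCutoff_eventuallyEq_one hΩ hη (hε k) hx hη2
      have c0 : χ k x = 1 := hψ.eq_of_nhds
      have c1 : ∀ v, fderiv ℝ (χ k) x v = 0 := fun v => by rw [hψ.fderiv_eq]; simp
      have c2 : ∀ i v, fderiv ℝ (TestFunction.partialDeriv (χ k) i) x v = 0 := fun i v => by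
        have : (TestFunction.partialDeriv (χ k) i : Eucl n → ℝ) =ᶠ[𝓝 x] fun _ => 0 :=
          fderiv_boundaryCutoff_eventuallyEq_zero hΩ hη (hε k) hx hη2 _
        rw [this.fderiv_eq]; simp
      have hz : jetSize (H k - h) x = 0 := by
        simp [jetSize, b0, b1, b2, a0, a1, a2, c0, c1, c2]
      rw [hz, mul_zero] at a3
      have e1 : L (g + H k) x = L (g + h) x := by simpa [sub_eq_zero] using a3
      have e2 : (H k).fn x = h.fn x := by rw [a0, c0, one_mul]
      simp only [Φ, Φ₀, e1, e2]
    filter_upwards [ae_all_iff.2 hae, D.ae_mem] with x hx hxΩ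
    -- Since η(x) > 0, the sequence at x is eventually constant.
    refine tendsto_const_nhds.congr' ?_
    have hto : Tendsto (fun k => 2 * ε k) atTop (𝓝 0) := by
      simpa [ε] using (tendsto_one_div_add_atTop_nhds_zero_nat (𝕜 := ℝ)).const_mul 2
    filter_upwards [hto.eventually (gt_mem_nhds (hη.mem_Ioo x hxΩ).1)] with k hk
    exact (hx k hk).symm
  have hmeas : ∀ k, AEStronglyMeasurable (Φ k) D.measure := fun k =>
    ((Lp.aestronglyMeasurable _).mul
      ((Lp.aestronglyMeasurable _).sub (Lp.aestronglyMeasurable _))).add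
      (((Lp.aestronglyMeasurable _).mul (Lp.aestronglyMeasurable _)).const_mul γ)
  have hconv := tendsto_integral_of_dominated_convergence J hmeas hJ hbound hlim
  have hle := le_of_tendsto' hconv hneg
  rw [hint] at hle
  linarith

end Monotonicity

/-! ### Bounded nonconstant activations are discriminatory -/

section Discriminatory

theorem exists_polynomial_antiderivative (P : Polynomial ℝ) :
    ∃ R : Polynomial ℝ, Polynomial.derivative R = P := by
  induction P using Polynomial.induction_on' with
  | add p q hp hq =>
    obtain ⟨a, rfl⟩ := hp
    obtain ⟨b, rfl⟩ := hq
    exact ⟨a + b, Polynomial.derivative_add⟩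
  | monomial m a =>
    refine ⟨Polynomial.monomial (m + 1) (a / (m + 1)), ?_⟩
    rw [Polynomial.derivative_monomial]
    have : (m : ℝ) + 1 ≠ 0 := by positivity
    congr 1
    push_cast
    field_simp

theorem exists_polynomial_of_iteratedDeriv_eq_zero (k : ℕ) : ∀ f : ℝ → ℝ,
    ContDiff ℝ (⊤ : ℕ∞) f → (∀ x, iteratedDeriv k f x = 0) →
      ∃ P : Polynomial ℝ, ∀ x, f x = P.eval x := by
  induction k with
  | zero => exact fun f _ h => ⟨0, fun x => by simpa using h x⟩
  | succ k ih =>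
    intro f hf h
    have hf' : ContDiff ℝ (⊤ : ℕ∞) (deriv f) := (contDiff_infty_iff_deriv.1 hf).2
    obtain ⟨P, hP⟩ := ih (deriv f) hf' fun x => by
      rw [← iteratedDeriv_succ']; exact h x
    obtain ⟨R, rfl⟩ := exists_polynomial_antiderivative P
    have hd : Differentiable ℝ f := (contDiff_infty_iff_deriv.1 hf).1
    refine ⟨R + Polynomial.C (f 0 - R.eval 0), fun x => ?_⟩
    have := is_const_of_deriv_eq_zero (f := fun y => f y - R.eval y)
      (hd.sub R.differentiable) (fun y => by
        rw [deriv_fun_sub (hd y) R.differentiableAt, hP, Polynomial.deriv, sub_self]) x 0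
    simp only [Polynomial.eval_add, Polynomial.eval_C]
    linarith

/-- A bounded smooth function with an identically vanishing derivative of some order is
constant. -/
theorem eq_const_of_iteratedDeriv_eq_zero {f : ℝ → ℝ} (hf : ContDiff ℝ (⊤ : ℕ∞) f) {C : ℝ}
    (hb : ∀ x, |f x| ≤ C) {k : ℕ} (h : ∀ x, iteratedDeriv k f x = 0) : ∃ a, ∀ x, f x = a := by
  obtain ⟨P, hP⟩ := exists_polynomial_of_iteratedDeriv_eq_zero k f hf h
  have hdeg : P.degree ≤ 0 := by
    rw [← Polynomial.isBoundedUnder_abs_atTop_iff]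
    exact isBoundedUnder_of ⟨C, fun x => by rw [← hP]; exact hb x⟩
  rw [Polynomial.eq_C_of_degree_le_zero hdeg] at hP
  exact ⟨P.coeff 0, fun x => by simpa using hP x⟩

theorem abs_mollify_le {σ : ℝ → ℝ} {C : ℝ} (hb : ∀ x, |σ x| ≤ C)
    (φ : ContDiffBump (0 : ℝ)) (x : ℝ) : |mollify φ σ x| ≤ C := by
  rw [mollify_apply]
  calc |∫ t, φ.normed volume t * σ (x - t)| ≤ ∫ t, φ.normed volume t * C := by
        have hi : Integrable (φ.normed volume) volume := φ.integrable_normed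
        rw [← Real.norm_eq_abs]
        refine norm_integral_le_of_norm_le (hi.mul_const C)
          (Eventually.of_forall fun t => ?_)
        rw [norm_mul, Real.norm_of_nonneg (φ.nonneg_normed t)]
        exact mul_le_mul_of_nonneg_left (hb _) (φ.nonneg_normed t)
    _ = C := by rw [integral_mul_const, φ.integral_normed, one_mul]

/-- Mollifications converge pointwise to σ; if all were constant, so would σ be. -/
theorem exists_mollify_nonconstant {σ : ℝ → ℝ} (hc : Continuous σ)
    (hn : ¬ ∃ a, ∀ x, σ x = a) :
    ∃ φ : ContDiffBump (0 : ℝ), ¬ ∃ a, ∀ x, mollify φ σ x = a := by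
  by_contra! H
  refine hn ⟨σ 0, fun x => ?_⟩
  have ht : ∀ y, Tendsto (fun k => mollify (bumpSeq ℝ one_pos k) σ y) atTop (𝓝 (σ y)) := fun y =>
    ContDiffBump.convolution_tendsto_right_of_continuous (tendsto_bumpSeq_rOut one_pos) hc y
  refine tendsto_nhds_unique (ht x) ((ht 0).congr fun k => ?_)
  obtain ⟨a, ha⟩ := H (bumpSeq ℝ one_pos k)
  rw [ha, ha]

variable {n : ℕ} {μ : Measure (Eucl n)} [IsFiniteMeasure μ] {G : Eucl n → ℝ}

/-- Mollifying σ averages over shifts of b, so orthogonality persists by Fubini. This replaces σ by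
a smooth bounded function. -/
theorem integral_mul_mollify_eq_zero (hG : Integrable G μ) {σ : ℝ → ℝ} (hc : Continuous σ) {C : ℝ}
    (hb : ∀ x, |σ x| ≤ C) (h : ∀ w b, ∫ x, G x * σ (⟪w, x⟫_ℝ + b) ∂μ = 0)
    (φ : ContDiffBump (0 : ℝ)) (w : Eucl n) (b : ℝ) :
    ∫ x, G x * mollify φ σ (⟪w, x⟫_ℝ + b) ∂μ = 0 := by
  have hi : Integrable (fun p : Eucl n × ℝ =>
      (G p.1 * φ.normed volume p.2) * σ (⟪w, p.1⟫_ℝ + b - p.2)) (μ.prod volume) := by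
    refine (hG.mul_prod φ.integrable_normed).mul_bdd (c := C) ?_ (Eventually.of_forall fun p => hb _)
    have : Continuous fun p : Eucl n × ℝ => σ (⟪w, p.1⟫_ℝ + b - p.2) := by fun_prop
    exact this.aestronglyMeasurable
  calc ∫ x, G x * mollify φ σ (⟪w, x⟫_ℝ + b) ∂μ
      = ∫ x, (∫ t, (G x * φ.normed volume t) * σ (⟪w, x⟫_ℝ + b - t)) ∂μ := by
        refine integral_congr_ae (Eventually.of_forall fun x => ?_)
        simp only [mollify_apply, ← integral_const_mul, mul_assoc]
    _ = ∫ t, ∫ x, (G x * φ.normed volume t) * σ (⟪w, x⟫_ℝ + b - t) ∂μ :=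
        integral_integral_swap hi
    _ = ∫ t, φ.normed volume t * ∫ x, G x * σ (⟪w, x⟫_ℝ + (b - t)) ∂μ := by
        refine integral_congr_ae (Eventually.of_forall fun t => ?_)
        simp only [← integral_const_mul]
        refine integral_congr_ae (Eventually.of_forall fun x => ?_)
        simp only [add_sub_assoc]
        ring
    _ = 0 := by simp [h]

/-- Differentiate k times in the scale l under the integral; bounded x and l keep the argument of τ
in a compact set, which gives the domination. At l = 0 the derivative of τ becomes a constant,
leaving a moment of G. -/
theorem integral_pow_mul_iteratedDeriv_eq_zero (hG : Integrable G μ) {R : ℝ}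
    (hR : ∀ᵐ x ∂μ, ‖x‖ ≤ R) {τ : ℝ → ℝ} (hτ : ContDiff ℝ (⊤ : ℕ∞) τ)
    (h : ∀ w b, ∫ x, G x * τ (⟪w, x⟫_ℝ + b) ∂μ = 0) (w : Eucl n) (b : ℝ) (k : ℕ) :
    ∀ l : ℝ, ∫ x, G x * ⟪w, x⟫_ℝ ^ k * iteratedDeriv k τ (l * ⟪w, x⟫_ℝ + b) ∂μ = 0 := by
  have hin : ∀ᵐ x ∂μ, |⟪w, x⟫_ℝ| ≤ ‖w‖ * |R| := by
    filter_upwards [hR] with x hx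
    exact (abs_real_inner_le_norm w x).trans
      (mul_le_mul_of_nonneg_left (hx.trans (le_abs_self R)) (norm_nonneg _))
  have hcd : ∀ k, Continuous (iteratedDeriv k τ) := fun k =>
    hτ.continuous_iteratedDeriv k (by exact_mod_cast le_top)
  have hmeas : ∀ k l, AEStronglyMeasurable
      (fun x => G x * ⟪w, x⟫_ℝ ^ k * iteratedDeriv k τ (l * ⟪w, x⟫_ℝ + b)) μ := by
    intro k l
    have h1 : Continuous fun x : Eucl n => ⟪w, x⟫_ℝ ^ k := by fun_prop
    have h2 : Continuous fun x : Eucl n => iteratedDeriv k τ (l * ⟪w, x⟫_ℝ + b) :=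
      (hcd k).comp (by fun_prop)
    exact (hG.1.mul h1.aestronglyMeasurable).mul h2.aestronglyMeasurable
  have hbound : ∀ k (l₀ : ℝ), ∃ C : ℝ, ∀ᵐ x ∂μ, ∀ l ∈ Metric.ball l₀ 1,
      ‖G x * ⟪w, x⟫_ℝ ^ k * iteratedDeriv k τ (l * ⟪w, x⟫_ℝ + b)‖ ≤ |G x| * C := by
    intro k l₀
    obtain ⟨A, hA⟩ := (isCompact_closedBall (0 : ℝ)
      ((|l₀| + 1) * (‖w‖ * |R|) + |b|)).exists_bound_of_continuousOn (hcd k).continuousOn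
    refine ⟨(‖w‖ * |R|) ^ k * A, ?_⟩
    filter_upwards [hin] with x hx l hl
    have hl' : |l| ≤ |l₀| + 1 := by
      have h1 : |l - l₀| < 1 := by simpa [Real.dist_eq] using hl
      have h2 := abs_sub_abs_le_abs_sub l l₀
      linarith
    rw [norm_mul, norm_mul, norm_pow, mul_assoc]
    refine mul_le_mul_of_nonneg_left (mul_le_mul (pow_le_pow_left₀ (norm_nonneg _) hx k)
      (hA _ ?_) (norm_nonneg _) (by positivity)) (norm_nonneg _)
    rw [mem_closedBall_zero_iff, Real.norm_eq_abs]
    refine (abs_add_le _ _).trans (add_le_add_left ?_ _)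
    rw [abs_mul]
    exact mul_le_mul hl' hx (abs_nonneg _) (by positivity)
  induction k with
  | zero =>
    intro l
    have := h (l • w) b
    simpa [real_inner_smul_left] using this
  | succ k ih =>
    intro l₀
    obtain ⟨C, hC⟩ := hbound (k + 1) l₀
    obtain ⟨C', hC'⟩ := hbound k l₀
    have key := hasDerivAt_integral_of_dominated_loc_of_deriv_le (μ := μ) (x₀ := l₀)
      (s := Metric.ball l₀ 1)
      (F := fun l x => G x * ⟪w, x⟫_ℝ ^ k * iteratedDeriv k τ (l * ⟪w, x⟫_ℝ + b))
      (F' := fun l x => G x * ⟪w, x⟫_ℝ ^ (k + 1) * iteratedDeriv (k + 1) τ (l * ⟪w, x⟫_ℝ + b))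
      (bound := fun x => |G x| * C) (Metric.ball_mem_nhds _ one_pos)
      (Eventually.of_forall fun l => hmeas k l)
      ((hG.abs.mul_const C').mono' (hmeas k l₀)
        (hC'.mono fun x hx => hx l₀ (Metric.mem_ball_self one_pos)))
      (hmeas (k + 1) l₀) hC (hG.abs.mul_const C) (Eventually.of_forall fun x l _ => ?_)
    · have hz : (fun l : ℝ => ∫ x, G x * ⟪w, x⟫_ℝ ^ k * iteratedDeriv k τ (l * ⟪w, x⟫_ℝ + b) ∂μ)
          = fun _ => 0 := funext ih
      have h2 := key.2
      rw [hz] at h2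
      exact h2.unique (hasDerivAt_const _ _)
    · have h1 : HasDerivAt (iteratedDeriv k τ) (iteratedDeriv (k + 1) τ (l * ⟪w, x⟫_ℝ + b))
          (l * ⟪w, x⟫_ℝ + b) := by
        rw [iteratedDeriv_succ]
        exact ((hτ.differentiable_iteratedDeriv k (by exact_mod_cast WithTop.coe_lt_top _))
          _).hasDerivAt
      have h2 : HasDerivAt (fun l : ℝ => l * ⟪w, x⟫_ℝ + b) ⟪w, x⟫_ℝ l := by
        simpa using ((hasDerivAt_id l).mul_const ⟪w, x⟫_ℝ).add_const b
      have h3 := (h1.comp l h2).const_mul (G x * ⟪w, x⟫_ℝ ^ k)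
      refine h3.congr_deriv ?_
      ring

/-- Since ⟪w, x⟫ is essentially bounded, the exponential series may be integrated term by term. -/
theorem integral_cexp_eq_zero_of_moments (hG : Integrable G μ) {R : ℝ}
    (hR : ∀ᵐ x ∂μ, ‖x‖ ≤ R) (w : Eucl n) (h : ∀ k : ℕ, ∫ x, G x * ⟪w, x⟫_ℝ ^ k ∂μ = 0) :
    ∫ x, (G x : ℂ) * Complex.exp (⟪w, x⟫_ℝ * Complex.I) ∂μ = 0 := by
  have hin : ∀ᵐ x ∂μ, |⟪w, x⟫_ℝ| ≤ ‖w‖ * |R| := by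
    filter_upwards [hR] with x hx
    exact (abs_real_inner_le_norm w x).trans
      (mul_le_mul_of_nonneg_left (hx.trans (le_abs_self R)) (norm_nonneg _))
  set F : ℕ → Eucl n → ℂ := fun k x =>
    ((G x * ⟪w, x⟫_ℝ ^ k : ℝ) : ℂ) * (Complex.I ^ k / (k.factorial : ℂ))
  have hnorm : ∀ k, ∀ᵐ x ∂μ, ‖F k x‖ ≤ |G x| * ((‖w‖ * |R|) ^ k / k.factorial) := by
    intro k
    filter_upwards [hin] with x hx
    simp only [F, norm_mul, norm_div, norm_pow, Complex.norm_I, one_pow, Complex.norm_real,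
      Complex.norm_natCast, Real.norm_eq_abs, mul_assoc]
    refine mul_le_mul_of_nonneg_left ?_ (abs_nonneg _)
    rw [mul_one_div]
    exact div_le_div_of_nonneg_right (pow_le_pow_left₀ (abs_nonneg _) hx k) (by positivity)
  have hmeas : ∀ k, AEStronglyMeasurable (F k) μ := by
    intro k
    have h1 : Continuous fun x : Eucl n => ⟪w, x⟫_ℝ ^ k := by fun_prop
    exact (Complex.continuous_ofReal.comp_aestronglyMeasurable
      (hG.1.mul h1.aestronglyMeasurable)).mul_const _
  have hsum := hasSum_integral_of_dominated_convergence (μ := μ) (F := F)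
    (f := fun x => (G x : ℂ) * Complex.exp (⟪w, x⟫_ℝ * Complex.I))
    (fun k x => |G x| * ((‖w‖ * |R|) ^ k / k.factorial)) hmeas hnorm
    (Eventually.of_forall fun x => (Real.summable_pow_div_factorial _).mul_left _)
    (by
      simp_rw [tsum_mul_left]
      exact hG.abs.mul_const _)
    (Eventually.of_forall fun x => by
      have := (NormedSpace.expSeries_div_hasSum_exp (𝔸 := ℂ) (⟪w, x⟫_ℝ * Complex.I)).mul_left
        (G x : ℂ)
      rw [← Complex.exp_eq_exp_ℂ] at this
      have e : (fun k => F k x)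
          = fun k => (G x : ℂ) * ((⟪w, x⟫_ℝ * Complex.I) ^ k / (k.factorial : ℂ)) := by
        funext k
        simp only [F]
        push_cast
        ring
      rw [e]
      exact this)
  have hz : ∀ k, ∫ x, F k x ∂μ = 0 := by
    intro k
    simp only [F]
    rw [integral_mul_const, integral_complex_ofReal, h k]
    simp
  simp only [hz] at hsum
  exact (hsum.unique hasSum_zero)

/-- The positive and negative parts of G are densities of finite measures with the same
characteristic function, hence of the same measure. -/
theorem ae_eq_zero_of_integral_cexp (hG : Integrable G μ)
    (h : ∀ w : Eucl n, ∫ x, (G x : ℂ) * Complex.exp (⟪w, x⟫_ℝ * Complex.I) ∂μ = 0) :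
    G =ᵐ[μ] 0 := by
  have hfin : ∀ H : Eucl n → ℝ, Integrable H μ → ∫⁻ x, ENNReal.ofReal (H x) ∂μ ≠ ∞ := fun H hH =>
    (lt_of_le_of_lt (lintegral_mono fun x => Real.ofReal_le_enorm _) hH.2).ne
  have f1 := hfin G hG
  have f2 := hfin (-G) hG.neg
  have m1 : AEMeasurable (fun x => ENNReal.ofReal (G x)) μ := hG.1.aemeasurable.ennreal_ofReal
  have m2 : AEMeasurable (fun x => ENNReal.ofReal ((-G) x)) μ :=
    hG.neg.1.aemeasurable.ennreal_ofReal
  have hint : ∀ (w : Eucl n) (H : Eucl n → ℝ), Integrable H μ → Integrable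
      (fun x => (ENNReal.ofReal (H x)).toReal • Complex.exp (⟪x, w⟫_ℝ * Complex.I)) μ := by
    intro w H hH
    have hc : Continuous fun x : Eucl n => Complex.exp (⟪x, w⟫_ℝ * Complex.I) := by fun_prop
    refine hH.mono (hH.1.aemeasurable.ennreal_ofReal.ennreal_toReal.aestronglyMeasurable.smul
      hc.aestronglyMeasurable) (Eventually.of_forall fun x => ?_)
    rw [norm_smul, Complex.norm_exp_ofReal_mul_I, mul_one, ENNReal.toReal_ofReal',
      Real.norm_of_nonneg (le_max_right _ _)]
    exact max_le (le_abs_self _) (abs_nonneg _)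
  have := isFiniteMeasure_withDensity f1
  have := isFiniteMeasure_withDensity f2
  have heq : μ.withDensity (fun x => ENNReal.ofReal (G x))
      = μ.withDensity (fun x => ENNReal.ofReal ((-G) x)) := by
    refine Measure.ext_of_charFun (funext fun w => ?_)
    rw [charFun_apply, charFun_apply,
      integral_withDensity_eq_integral_toReal_smul₀ m1 (by simp),
      integral_withDensity_eq_integral_toReal_smul₀ m2 (by simp), ← sub_eq_zero, ← integral_sub]
    · rw [← h w]
      refine integral_congr_ae (Eventually.of_forall fun x => ?_)
      simp only [ENNReal.toReal_ofReal', Pi.neg_apply, real_inner_comm, Complex.real_smul]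
      rw [← sub_mul, ← Complex.ofReal_sub, max_zero_sub_max_neg_zero_eq_self]
    · exact hint w G hG
    · exact hint w (-G) hG.neg
  have hae := (withDensity_eq_iff m1 m2 f1).1 heq
  filter_upwards [hae] with x hx
  have := congrArg ENNReal.toReal hx
  simp only [ENNReal.toReal_ofReal', Pi.neg_apply] at this
  have h2 := max_zero_sub_max_neg_zero_eq_self (G x)
  rw [this, sub_self] at h2
  exact h2.symm

/-- A bounded nonconstant continuous activation function is discriminatory. -/
theorem ae_eq_zero_of_forall_integral_ridge (hG : Integrable G μ) {R : ℝ}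
    (hR : ∀ᵐ x ∂μ, ‖x‖ ≤ R) {σ : ℝ → ℝ} (hc : Continuous σ) {C : ℝ} (hb : ∀ x, |σ x| ≤ C)
    (hn : ¬ ∃ a, ∀ x, σ x = a) (h : ∀ w b, ∫ x, G x * σ (⟪w, x⟫_ℝ + b) ∂μ = 0) :
    G =ᵐ[μ] 0 := by
  obtain ⟨φ, hφ⟩ := exists_mollify_nonconstant hc hn
  have hτ : ContDiff ℝ (⊤ : ℕ∞) (mollify φ σ) := contDiff_mollify φ hc.locallyIntegrable
  have hτ0 := integral_mul_mollify_eq_zero hG hc hb h φ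
  refine ae_eq_zero_of_integral_cexp hG fun w =>
    integral_cexp_eq_zero_of_moments hG hR w fun k => ?_
  -- Otherwise the mollified σ would be a bounded polynomial, hence constant. At this b the scale l
  -- = 0 isolates the k-th moment.
  obtain ⟨b, hb'⟩ : ∃ b, iteratedDeriv k (mollify φ σ) b ≠ 0 := by
    by_contra! H
    exact hφ (eq_const_of_iteratedDeriv_eq_zero hτ (abs_mollify_le hb φ) H)
  have := integral_pow_mul_iteratedDeriv_eq_zero hG hR hτ hτ0 w b k 0
  simp only [zero_mul, zero_add] at this
  rw [integral_mul_const] at this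
  exact (mul_eq_zero.1 this).resolve_right hb'

end Discriminatory

/-! ### Integral operators built from random features -/

section FeatureOperator

variable {X S : Type*} [MeasurableSpace X] [MeasurableSpace S] {μ : Measure X} [IsFiniteMeasure μ]
  {P : Measure S} [IsProbabilityMeasure P] {ι : Type*} [Fintype ι]

/-- A finite family of measurable random features, bounded by a multiple of `e ≤ 1`. -/
structure IsFeatureFamily (ψ : ι → S → X → ℝ) (e : X → ℝ) (M : ℝ) : Prop where
  measurable : ∀ m, Measurable fun p : S × X => ψ m p.1 p.2
  nonneg : 0 ≤ M
  e_nonneg : ∀ x, 0 ≤ e x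
  e_le : ∀ x, e x ≤ 1
  bound : ∀ m s x, |ψ m s x| ≤ M * e x

/-- The pairing of a feature with a function. -/
def featurePairing (μ : Measure X) (ψ : S → X → ℝ) (v : X → ℝ) (s : S) : ℝ :=
  ∫ x, ψ s x * v x ∂μ

/-- The integral operator with kernel `∑ₘ E[ψₘ(x) ψₘ(y)]`. -/
def featureOp (μ : Measure X) (P : Measure S) (ψ : ι → S → X → ℝ) (v : X → ℝ) (y : X) : ℝ :=
  ∑ m, ∫ s, ψ m s y * featurePairing μ (ψ m) v s ∂P

variable {ψ : ι → S → X → ℝ} {e : X → ℝ} {M : ℝ} {u v : X → ℝ}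

theorem IsFeatureFamily.abs_le (h : IsFeatureFamily ψ e M) (m : ι) (s : S) (x : X) :
    |ψ m s x| ≤ M :=
  (h.bound m s x).trans (mul_le_of_le_one_right h.nonneg (h.e_le x))

theorem IsFeatureFamily.measurable_left (h : IsFeatureFamily ψ e M) (m : ι) (s : S) :
    Measurable (ψ m s) := (h.measurable m).comp measurable_prodMk_left

theorem IsFeatureFamily.measurable_right (h : IsFeatureFamily ψ e M) (m : ι) (x : X) :
    Measurable fun s => ψ m s x := (h.measurable m).comp measurable_prodMk_right

theorem IsFeatureFamily.integrable_mul (h : IsFeatureFamily ψ e M) (hv : Integrable v μ) (m : ι)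
    (s : S) : Integrable (fun x => ψ m s x * v x) μ :=
  hv.bdd_mul (c := M) (h.measurable_left m s).aestronglyMeasurable
    (Eventually.of_forall fun x => h.abs_le m s x)

theorem IsFeatureFamily.abs_pairing_le (h : IsFeatureFamily ψ e M) (hv : Integrable v μ) (m : ι)
    (s : S) : |featurePairing μ (ψ m) v s| ≤ M * ∫ x, |v x| ∂μ := by
  rw [featurePairing, ← integral_const_mul, ← Real.norm_eq_abs]
  refine norm_integral_le_of_norm_le (hv.abs.const_mul M) (Eventually.of_forall fun x => ?_)
  rw [norm_mul]
  exact mul_le_mul_of_nonneg_right (h.abs_le m s x) (abs_nonneg _)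

theorem IsFeatureFamily.measurable_pairing (h : IsFeatureFamily ψ e M) (hv : Measurable v)
    (m : ι) : Measurable (featurePairing μ (ψ m) v) := by
  refine StronglyMeasurable.measurable ?_
  refine StronglyMeasurable.integral_prod_right (f := fun s x => ψ m s x * v x) ?_
  exact ((h.measurable m).mul (hv.comp measurable_snd)).stronglyMeasurable

theorem IsFeatureFamily.measurable_featureOp (h : IsFeatureFamily ψ e M) (hv : Measurable v) :
    Measurable (featureOp μ P ψ v) := by
  refine Finset.measurable_fun_sum _ fun m _ => StronglyMeasurable.measurable ?_
  refine StronglyMeasurable.integral_prod_right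
    (f := fun y s => ψ m s y * featurePairing μ (ψ m) v s) ?_
  exact (((h.measurable m).comp measurable_swap).mul
    ((h.measurable_pairing hv m).comp measurable_snd)).stronglyMeasurable

/-- The factor e(y) is kept rather than bounded by 1: with e = η it is the boundary decay that
`inner_le_of_abs_le` asks of an increment. -/
theorem IsFeatureFamily.abs_featureOp_le (h : IsFeatureFamily ψ e M) (hv : Integrable v μ)
    (y : X) : |featureOp μ P ψ v y| ≤ (Fintype.card ι * (M * (M * ∫ x, |v x| ∂μ))) * e y := by
  refine (Finset.abs_sum_le_sum_abs _ _).trans ?_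
  have : ∀ m ∈ (Finset.univ : Finset ι), |∫ s, ψ m s y * featurePairing μ (ψ m) v s ∂P|
      ≤ (M * (M * ∫ x, |v x| ∂μ)) * e y := by
    intro m _
    have h1 := norm_integral_le_of_norm_le (μ := P)
      (f := fun s => ψ m s y * featurePairing μ (ψ m) v s)
      (integrable_const ((M * e y) * (M * ∫ x, |v x| ∂μ))) (Eventually.of_forall fun s => by
        rw [norm_mul]
        exact mul_le_mul (h.bound m s y) (h.abs_pairing_le hv m s) (norm_nonneg _)
          (mul_nonneg h.nonneg (h.e_nonneg y)))
    rw [Real.norm_eq_abs] at h1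
    refine h1.trans (le_of_eq ?_)
    simp
    ring
  refine (Finset.sum_le_sum this).trans (le_of_eq ?_)
  simp
  ring

/-- `featureOp` is the integral operator with kernel `∑ₘ E[ψₘ(x) ψₘ(y)]`. -/
theorem IsFeatureFamily.featureOp_eq_integral (h : IsFeatureFamily ψ e M) (hv : Integrable v μ)
    (y : X) : featureOp μ P ψ v y = ∫ x, (∑ m, ∫ s, ψ m s x * ψ m s y ∂P) * v x ∂μ := by
  have hi : ∀ m, Integrable (fun p : X × S => ψ m p.2 p.1 * ψ m p.2 y * v p.1) (μ.prod P) := by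
    intro m
    refine (hv.comp_fst P).bdd_mul (c := M * M) ?_ (Eventually.of_forall fun p => ?_)
    · exact (((h.measurable m).comp measurable_swap).mul
        ((h.measurable_right m y).comp measurable_snd)).aestronglyMeasurable
    · rw [norm_mul]
      exact mul_le_mul (h.abs_le m _ _) (h.abs_le m _ _) (norm_nonneg _) h.nonneg
  have h1 : ∀ x, (∑ m, ∫ s, ψ m s x * ψ m s y ∂P) * v x
      = ∑ m, ∫ s, ψ m s x * ψ m s y * v x ∂P := by
    intro x
    rw [Finset.sum_mul]
    simp only [integral_mul_const]
  simp only [h1]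
  rw [integral_finsetSum _ fun m _ => (hi m).integral_prod_left, featureOp]
  refine Finset.sum_congr rfl fun m _ => ?_
  rw [integral_integral_swap (hi m)]
  refine integral_congr_ae (Eventually.of_forall fun s => ?_)
  simp only [featurePairing, ← integral_const_mul]
  refine integral_congr_ae (Eventually.of_forall fun x => ?_)
  simp only
  ring

theorem IsFeatureFamily.integral_featureOp_mul (h : IsFeatureFamily ψ e M) (hvm : Measurable v)
    (hv : Integrable v μ) (hu : Integrable u μ) :
    ∫ y, featureOp μ P ψ v y * u y ∂μ
      = ∑ m, ∫ s, featurePairing μ (ψ m) v s * featurePairing μ (ψ m) u s ∂P := by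
  have hi : ∀ m, Integrable
      (fun p : X × S => ψ m p.2 p.1 * featurePairing μ (ψ m) v p.2 * u p.1) (μ.prod P) := by
    intro m
    refine (hu.comp_fst P).bdd_mul (c := M * (M * ∫ x, |v x| ∂μ)) ?_
      (Eventually.of_forall fun p => ?_)
    · exact (((h.measurable m).comp measurable_swap).mul
        ((h.measurable_pairing hvm m).comp measurable_snd)).aestronglyMeasurable
    · rw [norm_mul]
      exact mul_le_mul (h.abs_le m _ _) (h.abs_pairing_le hv m _) (norm_nonneg _) h.nonneg
  have h1 : ∀ y, featureOp μ P ψ v y * u y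
      = ∑ m, ∫ s, ψ m s y * featurePairing μ (ψ m) v s * u y ∂P := by
    intro y
    rw [featureOp, Finset.sum_mul]
    simp only [integral_mul_const]
  simp only [h1]
  rw [integral_finsetSum _ fun m _ => (hi m).integral_prod_left]
  refine Finset.sum_congr rfl fun m _ => ?_
  rw [integral_integral_swap (hi m)]
  refine integral_congr_ae (Eventually.of_forall fun s => ?_)
  simp only [featurePairing]
  rw [← integral_const_mul]
  refine integral_congr_ae (Eventually.of_forall fun x => ?_)
  simp only
  ring

theorem Lp.integrable_two (v : Lp ℝ 2 μ) : Integrable v μ := (Lp.memLp v).integrable (by norm_num)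

theorem IsFeatureFamily.memLp_featureOp (h : IsFeatureFamily ψ e M) (v : Lp ℝ 2 μ) :
    MemLp (featureOp μ P ψ v) 2 μ := by
  refine MemLp.of_bound
    (h.measurable_featureOp (Lp.stronglyMeasurable v).measurable).aestronglyMeasurable
    (Fintype.card ι * (M * (M * ∫ x, |v x| ∂μ))) (Eventually.of_forall fun y => ?_)
  have hM := h.nonneg
  refine (h.abs_featureOp_le (Lp.integrable_two v) y).trans
    (mul_le_of_le_one_right ?_ (h.e_le y))
  have : 0 ≤ ∫ x, |v x| ∂μ := integral_nonneg fun _ => abs_nonneg _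
  positivity

theorem featureOp_congr {v' : X → ℝ} (hv : v =ᵐ[μ] v') :
    featureOp μ P ψ v = featureOp μ P ψ v' := by
  have : ∀ m, featurePairing μ (ψ m) v = featurePairing μ (ψ m) v' := fun m => funext fun s =>
    integral_congr_ae (hv.mono fun x hx => by simp only [hx])
  funext y
  simp only [featureOp, this]

theorem IsFeatureFamily.featureOp_linear (h : IsFeatureFamily ψ e M) (hvm : Measurable v)
    (hum : Measurable u) (hv : Integrable v μ) (hu : Integrable u μ) (a b : ℝ) :
    featureOp μ P ψ (fun x => a * v x + b * u x)
      = fun y => a * featureOp μ P ψ v y + b * featureOp μ P ψ u y := by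
  have hp : ∀ m s, featurePairing μ (ψ m) (fun x => a * v x + b * u x) s
      = a * featurePairing μ (ψ m) v s + b * featurePairing μ (ψ m) u s := by
    intro m s
    simp only [featurePairing]
    rw [← integral_const_mul, ← integral_const_mul,
      ← integral_add ((h.integrable_mul hv m s).const_mul a)
        ((h.integrable_mul hu m s).const_mul b)]
    refine integral_congr_ae (Eventually.of_forall fun x => ?_)
    ring
  have hi : ∀ {z : X → ℝ} (_ : Measurable z) (_ : Integrable z μ) (m : ι) (y : X),
      Integrable (fun s => ψ m s y * featurePairing μ (ψ m) z s) P := fun hzm hz m y =>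
    Integrable.of_bound ((h.measurable_right m y).mul
      (h.measurable_pairing hzm m)).aestronglyMeasurable (M * (M * ∫ x, |_| ∂μ))
      (Eventually.of_forall fun s => by
        rw [norm_mul]
        exact mul_le_mul (h.abs_le m s y) (h.abs_pairing_le hz m s) (norm_nonneg _) h.nonneg)
  funext y
  simp only [featureOp, Finset.mul_sum, ← Finset.sum_add_distrib]
  refine Finset.sum_congr rfl fun m _ => ?_
  rw [← integral_const_mul, ← integral_const_mul,
    ← integral_add ((hi hvm hv m y).const_mul a) ((hi hum hu m y).const_mul b)]
  refine integral_congr_ae (Eventually.of_forall fun s => ?_)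
  simp only [hp]
  ring

/-- The feature operator on `L²`. -/
def featureLinearMap (P : Measure S) [IsProbabilityMeasure P] (h : IsFeatureFamily ψ e M) :
    Lp ℝ 2 μ →ₗ[ℝ] Lp ℝ 2 μ where
  toFun v := (h.memLp_featureOp (P := P) v).toLp _
  map_add' u v := by
    rw [← MemLp.toLp_add]
    refine MemLp.toLp_congr _ _ (Eventually.of_forall fun y => ?_)
    rw [featureOp_congr (Lp.coeFn_add u v)]
    have := h.featureOp_linear (P := P) (Lp.stronglyMeasurable u).measurable
      (Lp.stronglyMeasurable v).measurable (Lp.integrable_two u) (Lp.integrable_two v) 1 1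
    simp only [one_mul] at this
    exact congrFun this y
  map_smul' a v := by
    rw [RingHom.id_apply, ← MemLp.toLp_const_smul]
    refine MemLp.toLp_congr _ _ (Eventually.of_forall fun y => ?_)
    rw [featureOp_congr (Lp.coeFn_smul a v)]
    have := h.featureOp_linear (P := P) (Lp.stronglyMeasurable v).measurable
      (Lp.stronglyMeasurable v).measurable (Lp.integrable_two v) (Lp.integrable_two v) a 0
    simp only [zero_mul, add_zero] at this
    exact congrFun this y

theorem featureLinearMap_ae (h : IsFeatureFamily ψ e M) (v : Lp ℝ 2 μ) :
    featureLinearMap P h v =ᵐ[μ] featureOp μ P ψ v :=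
  MemLp.coeFn_toLp (h.memLp_featureOp v)

/-- Symmetry, nonnegativity and the null vectors of the quadratic form are all read off from this
formula. -/
theorem inner_featureLinearMap (h : IsFeatureFamily ψ e M) (v u : Lp ℝ 2 μ) :
    ⟪featureLinearMap P h v, u⟫_ℝ
      = ∑ m, ∫ s, featurePairing μ (ψ m) v s * featurePairing μ (ψ m) u s ∂P := by
  rw [← h.integral_featureOp_mul (Lp.stronglyMeasurable v).measurable (Lp.integrable_two v)
    (Lp.integrable_two u), L2.inner_def]
  refine integral_congr_ae ?_
  filter_upwards [featureLinearMap_ae (P := P) h v] with x hx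
  simp [hx, mul_comm]

theorem isSymmetric_featureLinearMap (h : IsFeatureFamily ψ e M) :
    (featureLinearMap (μ := μ) P h).IsSymmetric := by
  intro v u
  rw [inner_featureLinearMap, real_inner_comm, inner_featureLinearMap]
  simp only [mul_comm]

theorem inner_featureLinearMap_self_nonneg (h : IsFeatureFamily ψ e M) (v : Lp ℝ 2 μ) :
    0 ≤ ⟪featureLinearMap P h v, v⟫_ℝ := by
  rw [inner_featureLinearMap]
  exact Finset.sum_nonneg fun m _ => integral_nonneg fun s => mul_self_nonneg _

theorem featurePairing_eq_zero_of_inner_eq_zero (h : IsFeatureFamily ψ e M) {v : Lp ℝ 2 μ}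
    (hv : ⟪featureLinearMap P h v, v⟫_ℝ = 0) (m : ι) :
    featurePairing μ (ψ m) v =ᵐ[P] 0 := by
  rw [inner_featureLinearMap, Finset.sum_eq_zero_iff_of_nonneg
    fun m _ => integral_nonneg fun s => mul_self_nonneg _] at hv
  have h1 := hv m (Finset.mem_univ m)
  have hm := h.measurable_pairing (μ := μ) (Lp.stronglyMeasurable v).measurable m
  have hM := h.nonneg
  rw [integral_eq_zero_iff_of_nonneg (fun s => mul_self_nonneg _)] at h1
  · filter_upwards [h1] with s hs
    exact mul_self_eq_zero.1 hs
  · refine Integrable.of_bound (hm.mul hm).aestronglyMeasurable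
      ((M * ∫ x, |v x| ∂μ) * (M * ∫ x, |v x| ∂μ)) (Eventually.of_forall fun s => ?_)
    rw [norm_mul]
    have := h.abs_pairing_le (Lp.integrable_two v) m s
    exact mul_self_le_mul_self (norm_nonneg _) this

end FeatureOperator

/-! ### The limit kernel as a positive definite operator -/

section LimitKernel

variable {n : ℕ} {Ω : TopologicalSpace.Opens (Eucl n)} {D : Density Ω}
  {S : Type*} [MeasurableSpace S] {P : Measure S} [IsProbabilityMeasure P]
  {c : S → ℝ} {w : S → Eucl n} {b : S → ℝ} {σ : ℝ → ℝ} {η : Eucl n → ℝ}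

/-- The restriction of `η` to `Ω`, extended by zero. -/
def auxIndicator (Ω : TopologicalSpace.Opens (Eucl n)) (η : Eucl n → ℝ) : Eucl n → ℝ :=
  (Ω : Set (Eucl n)).indicator η

/-- The random features of the limit kernel; `c` are the outer weights. -/
def features (Ω : TopologicalSpace.Opens (Eucl n)) (c : S → ℝ) (w : S → Eucl n) (b : S → ℝ)
    (σ : ℝ → ℝ) (η : Eucl n → ℝ) : Unit ⊕ Unit ⊕ Fin n → S → Eucl n → ℝ :=
  Sum.elim (fun _ s x => auxIndicator Ω η x * σ (⟪w s, x⟫_ℝ + b s))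
    (Sum.elim (fun _ s x => auxIndicator Ω η x * (c s * deriv σ (⟪w s, x⟫_ℝ + b s)))
      (fun i s x => auxIndicator Ω η x * (c s * deriv σ (⟪w s, x⟫_ℝ + b s) * x i)))

theorem IsActivation.exists_bound (hσ : IsActivation σ) : ∃ C : ℝ, 0 ≤ C ∧ (∀ t, |σ t| ≤ C) ∧
    ∀ t, |deriv σ t| ≤ C := by
  obtain ⟨C0, h0⟩ := hσ.ckb.2 0 (by norm_num)
  obtain ⟨C1, h1⟩ := hσ.ckb.2 1 (by norm_num)
  have h0' : ∀ t, |σ t| ≤ C0 := fun t => by simpa using h0 t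
  have h1' : ∀ t, |deriv σ t| ≤ C1 := fun t => by
    rw [← Real.norm_eq_abs, ← iteratedDeriv_one,
      ← norm_iteratedFDeriv_eq_norm_iteratedDeriv]
    exact h1 t
  exact ⟨max C0 C1, (abs_nonneg _).trans ((h0' 0).trans (le_max_left _ _)),
    fun t => (h0' t).trans (le_max_left _ _), fun t => (h1' t).trans (le_max_right _ _)⟩

theorem IsActivation.continuous (hσ : IsActivation σ) : Continuous σ := hσ.ckb.1.continuous

theorem IsActivation.continuous_deriv (hσ : IsActivation σ) : Continuous (deriv σ) :=
  hσ.ckb.1.continuous_deriv (by norm_num)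

theorem exists_isFeatureFamily (hΩ : Bornology.IsBounded (Ω : Set (Eucl n)))
    (hη : IsAuxiliary (Ω : Set (Eucl n)) η) (hσ : IsActivation σ) (hc : Measurable c)
    (hw : Measurable w) (hb : Measurable b) {K : ℝ} (hK : ∀ s, |c s| ≤ K) :
    ∃ M, IsFeatureFamily (features Ω c w b σ η) (auxIndicator Ω η) M := by
  obtain ⟨C, hC0, hC, hC'⟩ := hσ.exists_bound
  obtain ⟨R, hR⟩ := hΩ.exists_norm_le
  have hηm : Measurable (auxIndicator Ω η) :=
    hη.contDiff.continuous.measurable.indicator Ω.isOpen.measurableSet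
  have he0 : ∀ x, 0 ≤ auxIndicator Ω η x := fun x =>
    Set.indicator_nonneg (fun x hx => (hη.mem_Ioo x hx).1.le) x
  have hin : Measurable fun p : S × Eucl n => ⟪w p.1, p.2⟫_ℝ + b p.1 :=
    ((hw.comp measurable_fst).inner measurable_snd).add (hb.comp measurable_fst)
  have hmσ := hσ.continuous.measurable.comp hin
  have hmσ' := hσ.continuous_deriv.measurable.comp hin
  have hme : Measurable fun p : S × Eucl n => auxIndicator Ω η p.2 := hηm.comp measurable_snd
  have hmc : Measurable fun p : S × Eucl n => c p.1 := hc.comp measurable_fst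
  refine ⟨C + |K| * C + |K| * C * |R|, ?_, by positivity, he0, ?_, ?_⟩
  · rintro (_ | _ | i)
    · exact hme.mul hmσ
    · exact hme.mul (hmc.mul hmσ')
    · have hx : Measurable fun p : S × Eucl n => p.2 i := by fun_prop
      exact hme.mul ((hmc.mul hmσ').mul hx)
  · exact fun x => Set.indicator_le' (fun x hx => (hη.mem_Ioo x hx).2.le) (fun _ _ => zero_le_one) x
  · have hKC : 0 ≤ |K| * C := by positivity
    have hKCR : 0 ≤ |K| * C * |R| := by positivity
    have hcσ : ∀ s t, |c s * deriv σ t| ≤ |K| * C := fun s t => by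
      rw [abs_mul]
      exact mul_le_mul ((hK s).trans (le_abs_self K)) (hC' t) (abs_nonneg _) (abs_nonneg _)
    intro m s x
    by_cases hx : x ∈ (Ω : Set (Eucl n))
    · have key : ∀ z : ℝ, |z| ≤ C + |K| * C + |K| * C * |R| →
          |auxIndicator Ω η x * z| ≤ (C + |K| * C + |K| * C * |R|) * auxIndicator Ω η x := by
        intro z hz
        rw [abs_mul, abs_of_nonneg (he0 x), mul_comm]
        exact mul_le_mul_of_nonneg_right hz (he0 x)
      rcases m with _ | _ | i
      · exact key _ ((hC _).trans (by linarith))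
      · exact key _ ((hcσ _ _).trans (by linarith))
      · refine key _ ?_
        rw [abs_mul]
        have h1 : |x i| ≤ |R| :=
          (PiLp.norm_apply_le x i).trans ((hR x hx).trans (le_abs_self R))
        have := mul_le_mul (hcσ s (⟪w s, x⟫_ℝ + b s)) h1 (abs_nonneg _) hKC
        linarith
    · rcases m with _ | _ | i <;> simp [features, auxIndicator, hx]

/-- The three blocks of features produce the σσ term, the 1 and the x·y = ∑ x_i y_i of the factor
x·y + 1. -/
theorem sum_features {c' : S → ℝ} (hc' : c' =ᵐ[P] c) {M : ℝ}
    (h : IsFeatureFamily (features Ω c' w b σ η) (auxIndicator Ω η) M)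
    {x y : Eucl n} (hx : x ∈ Ω) (hy : y ∈ Ω) :
    ∑ m, ∫ s, features Ω c' w b σ η m s x * features Ω c' w b σ η m s y ∂P
      = limitKernel P c w b σ η x y := by
  have hi : ∀ m, Integrable
      (fun s => features Ω c' w b σ η m s x * features Ω c' w b σ η m s y) P := fun m =>
    Integrable.of_bound ((h.measurable_right m x).mul
      (h.measurable_right m y)).aestronglyMeasurable (M * M) (Eventually.of_forall fun s => by
        rw [norm_mul]
        exact mul_le_mul (h.abs_le m s x) (h.abs_le m s y) (norm_nonneg _) h.nonneg)
  rw [← integral_finsetSum _ fun m _ => hi m, limitKernel, ← integral_const_mul]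
  refine integral_congr_ae ?_
  filter_upwards [hc'] with s hs
  have ex : auxIndicator Ω η x = η x := Set.indicator_of_mem (show x ∈ (Ω : Set (Eucl n)) from hx) _
  have ey : auxIndicator Ω η y = η y := Set.indicator_of_mem (show y ∈ (Ω : Set (Eucl n)) from hy) _
  have hxy : ⟪x, y⟫_ℝ = ∑ i, x i * y i := by
    simp [PiLp.inner_apply, mul_comm]
  simp only [Fintype.sum_sum_type, features, Sum.elim_inl, Sum.elim_inr, ex, ey, hs,
    Finset.univ_unique, Finset.sum_singleton]
  have e3 : ∑ i, η x * (c s * deriv σ (⟪w s, x⟫_ℝ + b s) * x i)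
        * (η y * (c s * deriv σ (⟪w s, y⟫_ℝ + b s) * y i))
      = η x * η y * (c s ^ 2 * deriv σ (⟪w s, x⟫_ℝ + b s) * deriv σ (⟪w s, y⟫_ℝ + b s)
        * ⟪x, y⟫_ℝ) := by
    rw [hxy]
    simp only [Finset.mul_sum]
    refine Finset.sum_congr rfl fun i _ => ?_
    ring
  rw [e3]
  ring

/-- The integral operator of the limit kernel is a positive definite self-adjoint bounded operator
on `L²`, whose range consists of functions bounded by multiples of `η`. -/
theorem exists_limitOperator (hΩ : Bornology.IsBounded (Ω : Set (Eucl n)))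
    (hη : IsAuxiliary (Ω : Set (Eucl n)) η) (hσ : IsActivation σ)
    (hinit : IsInitialization P c w b) :
    ∃ T : D.L2 →L[ℝ] D.L2,
      (∀ v, T v =ᵐ[D.measure] integralOp D (limitKernel P c w b σ η) v) ∧
      (∀ u v, ⟪T u, v⟫_ℝ = ⟪u, T v⟫_ℝ) ∧ (∀ v, 0 ≤ ⟪T v, v⟫_ℝ) ∧
      (∀ v, ⟪T v, v⟫_ℝ = 0 → v = 0) ∧
      ∀ v, ∃ K : ℝ, ∀ᵐ x ∂D.measure, |T v x| ≤ K * η x := by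
  have := D.isFiniteMeasure hΩ
  obtain ⟨K, hK⟩ := hinit.bounded_c
  obtain ⟨s₀, hs₀⟩ := hK.exists
  have hK0 : 0 ≤ K := (abs_nonneg _).trans hs₀.le
  -- The bound on c holds only almost surely; clamping makes it hold everywhere without changing the
  -- kernel.
  set c' : S → ℝ := fun s => max (-K) (min (c s) K)
  have hc'm : Measurable c' := measurable_const.max (hinit.measurable_c.min measurable_const)
  have hc'b : ∀ s, |c' s| ≤ K := fun s =>
    abs_le.2 ⟨le_max_left _ _, max_le (by linarith) (min_le_right _ _)⟩
  have hc' : c' =ᵐ[P] c := by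
    filter_upwards [hK] with s hs
    have := abs_lt.1 hs
    simp only [c']
    rw [min_eq_left this.2.le, max_eq_right this.1.le]
  obtain ⟨M, hM⟩ := exists_isFeatureFamily hΩ hη hσ hc'm hinit.measurable_w hinit.measurable_b hc'b
  set T₀ := featureLinearMap (μ := D.measure) P hM
  have hsymm : T₀.IsSymmetric := isSymmetric_featureLinearMap hM
  have hind : ∀ x ∈ Ω, auxIndicator Ω η x = η x := fun x hx =>
    Set.indicator_of_mem (show x ∈ (Ω : Set (Eucl n)) from hx) _
  -- Boundedness comes from Hellinger–Toeplitz: an everywhere defined symmetric operator on a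
  -- Hilbert space is continuous.
  refine ⟨⟨T₀, hsymm.continuous⟩, fun v => ?_, fun u v => hsymm u v,
    fun v => inner_featureLinearMap_self_nonneg hM v, fun v hv => ?_, fun v => ?_⟩
  · filter_upwards [featureLinearMap_ae (P := P) hM v, D.ae_mem] with y hy hyΩ
    change T₀ v y = _
    rw [hy, hM.featureOp_eq_integral (Lp.integrable_two v), integralOp]
    refine integral_congr_ae ?_
    filter_upwards [D.ae_mem] with x hx
    rw [sum_features hc' hM hx hyΩ]
  -- The block of features ησ(w·x+b) alone suffices for injectivity.
  · have h0 := featurePairing_eq_zero_of_inner_eq_zero hM hv (Sum.inl ())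
    set G : Eucl n → ℝ := fun x => auxIndicator Ω η x * v x
    have hηm : Measurable (auxIndicator Ω η) :=
      hη.contDiff.continuous.measurable.indicator Ω.isOpen.measurableSet
    have hG : Integrable G D.measure := (Lp.integrable_two v).bdd_mul (c := 1)
      hηm.aestronglyMeasurable (Eventually.of_forall fun x => by
        rw [Real.norm_of_nonneg (hM.e_nonneg x)]; exact hM.e_le x)
    obtain ⟨C, hC0, hC, -⟩ := hσ.exists_bound
    set Ψ : Eucl n × ℝ → ℝ := fun p => ∫ x, G x * σ (⟪p.1, x⟫_ℝ + p.2) ∂D.measure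
    have hσc := hσ.continuous
    have hΨ : Continuous Ψ := by
      refine continuous_of_dominated (bound := fun x => |G x| * C) (fun p => ?_)
        (fun p => Eventually.of_forall fun x => ?_) (hG.abs.mul_const C)
        (Eventually.of_forall fun x => by fun_prop)
      · have : Continuous fun x : Eucl n => σ (⟪p.1, x⟫_ℝ + p.2) := by fun_prop
        exact hG.1.mul this.aestronglyMeasurable
      · rw [norm_mul]
        exact mul_le_mul_of_nonneg_left (hC _) (abs_nonneg _)
    -- The set where Ψ ≠ 0 is open; if nonempty it would have positive probability, yet Ψ(w, b) = 0
    -- almost surely.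
    have hΨ0 : ∀ p, Ψ p = 0 := by
      by_contra! hne
      obtain ⟨p, hp⟩ := hne
      have hpos := hinit.full_support (Ψ ⁻¹' {0}ᶜ) (isOpen_compl_singleton.preimage hΨ) ⟨p, hp⟩
      refine hpos.ne' (measure_mono_null ?_ (ae_iff.1 h0))
      intro s hs hs0
      refine hs ?_
      simp only [Set.mem_singleton_iff, Ψ, G]
      rw [Pi.zero_apply] at hs0
      rw [← hs0, featurePairing]
      refine integral_congr_ae (Eventually.of_forall fun x => ?_)
      simp only [features, Sum.elim_inl]
      ring
    obtain ⟨R, hR⟩ := hΩ.exists_norm_le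
    have hG0 := ae_eq_zero_of_forall_integral_ridge hG
      (D.ae_mem.mono fun x hx => hR x hx) hσc hC hσ.nonconstant fun w b => hΨ0 (w, b)
    rw [Lp.eq_zero_iff_ae_eq_zero]
    filter_upwards [hG0, D.ae_mem] with x hx hxΩ
    have h2 : η x * v x = 0 := by rw [← hind x hxΩ]; exact hx
    exact (mul_eq_zero.1 h2).resolve_left (hη.mem_Ioo x hxΩ).1.ne'
  · refine ⟨Fintype.card (Unit ⊕ Unit ⊕ Fin n) * (M * (M * ∫ x, |v x| ∂D.measure)), ?_⟩
    filter_upwards [featureLinearMap_ae (P := P) hM v, D.ae_mem] with y hy hyΩ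
    change |T₀ v y| ≤ _
    rw [hy, ← hind y hyΩ]
    exact hM.abs_featureOp_le (Lp.integrable_two v) y

end LimitKernel

/-! ### Weak convergence to zero in Hilbert spaces -/

section WeakConvergence

variable {H : Type*} [NormedAddCommGroup H] [InnerProductSpace ℝ H] [CompleteSpace H]

/-- By the Riesz representation, continuous functionals are inner products with vectors. -/
theorem tendsto_toWeakSpace_zero_iff {x : ℕ → H} :
    Tendsto (fun k => toWeakSpace ℝ H (x k)) atTop (𝓝 (toWeakSpace ℝ H 0)) ↔
      ∀ y, Tendsto (fun k => ⟪y, x k⟫_ℝ) atTop (𝓝 0) := by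
  constructor
  · intro h y
    have hc : Continuous fun z : WeakSpace ℝ H => (topDualPairing ℝ H).flip z (innerSL ℝ y) :=
      WeakBilin.eval_continuous _ (innerSL ℝ y)
    have := (hc.tendsto _).comp h
    have h0 : (topDualPairing ℝ H).flip (0 : H) (innerSL ℝ y) = 0 := by simp
    exact h0 ▸ this
  · intro h
    refine (WeakBilin.tendsto_iff_forall_eval_tendsto _ (fun a b hab => ?_)).2 fun l => ?_
    · have h1 : ⟪a - b, a⟫_ℝ = ⟪a - b, b⟫_ℝ := congrArg (fun f => f (innerSL ℝ (a - b))) hab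
      have h2 : ⟪a - b, a - b⟫_ℝ = 0 := by
        rw [inner_sub_right (𝕜 := ℝ) (a - b) a b, h1, sub_self]
      exact sub_eq_zero.1 (inner_self_eq_zero.1 h2)
    · have h1 := h ((InnerProductSpace.toDual ℝ H).symm l)
      simp only [InnerProductSpace.toDual_symm_apply] at h1
      have h0 : l (0 : H) = 0 := map_zero l
      exact h0 ▸ h1

theorem exists_bound_of_forall_tendsto_inner {x : ℕ → H}
    (h : ∀ y, Tendsto (fun k => ⟪y, x k⟫_ℝ) atTop (𝓝 0)) : ∃ C : ℝ, ∀ k, ‖x k‖ ≤ C := by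
  obtain ⟨C, hC⟩ := banach_steinhaus (g := fun k => innerSL ℝ (x k)) fun y => by
    obtain ⟨C, hC⟩ := (h y).norm.isBoundedUnder_le.bddAbove_range
    exact ⟨C, fun k => by
      rw [innerSL_apply_apply, real_inner_comm]
      exact hC ⟨k, rfl⟩⟩
  exact ⟨C, fun k => by simpa using hC k⟩

/-- A vector v orthogonal to the range satisfies ⟪Tv, v⟫ = 0, so the range is dense. For y = Tz
symmetry gives ⟪y, x_k⟫ = ⟪z, Tx_k⟫ → 0, and boundedness of x_k extends this to the closure. -/
theorem tendsto_inner_of_bounded {T : H →L[ℝ] H} (hsymm : ∀ u v, ⟪T u, v⟫_ℝ = ⟪u, T v⟫_ℝ)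
    (hinj : ∀ v, ⟪T v, v⟫_ℝ = 0 → v = 0) {x : ℕ → H} {C : ℝ} (hC : ∀ k, ‖x k‖ ≤ C)
    (hT : Tendsto (fun k => T (x k)) atTop (𝓝 0)) (y : H) :
    Tendsto (fun k => ⟪y, x k⟫_ℝ) atTop (𝓝 0) := by
  have hdense : (LinearMap.range T.toLinearMap).topologicalClosure = ⊤ := by
    rw [Submodule.topologicalClosure_eq_top_iff, Submodule.eq_bot_iff]
    intro v hv
    refine hinj v ?_
    exact (Submodule.mem_orthogonal _ v).1 hv (T v) ⟨v, rfl⟩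
  have hy : y ∈ closure (Set.range T) := by
    have : y ∈ (LinearMap.range T.toLinearMap).topologicalClosure := by rw [hdense]; trivial
    exact this
  have hC0 : 0 ≤ C := (norm_nonneg _).trans (hC 0)
  rw [Metric.tendsto_atTop']
  intro ε hε
  obtain ⟨_, ⟨z, rfl⟩, hz⟩ := Metric.mem_closure_iff.1 hy (ε / (2 * (C + 1))) (by positivity)
  have h1 : Tendsto (fun k => ⟪z, T (x k)⟫_ℝ) atTop (𝓝 0) := by
    simpa using (tendsto_const_nhds (x := z)).inner hT
  obtain ⟨N, hN⟩ := Metric.tendsto_atTop'.1 h1 (ε / 2) (by positivity)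
  refine ⟨N, fun k hk => ?_⟩
  have h2 := hN k hk
  rw [dist_zero_right, Real.norm_eq_abs] at h2 ⊢
  have h3 : ⟪y, x k⟫_ℝ = ⟪y - T z, x k⟫_ℝ + ⟪z, T (x k)⟫_ℝ := by
    rw [inner_sub_left, hsymm]; ring
  have h4 : |⟪y - T z, x k⟫_ℝ| ≤ ε / 2 := by
    refine (abs_real_inner_le_norm _ _).trans ?_
    rw [dist_eq_norm] at hz
    calc _ ≤ ε / (2 * (C + 1)) * C := mul_le_mul hz.le (hC k) (norm_nonneg _) (by positivity)
      _ ≤ ε / (2 * (C + 1)) * (C + 1) := by gcongr; linarith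
      _ = ε / 2 := by field_simp
  rw [h3]
  exact (abs_add_le _ _).trans_lt (by linarith)

end WeakConvergence

/-! ### Exceptional sets of finite measure -/

section Exceptional

/-- An integrable function on `(0, ∞)` tends to zero at infinity outside a set of finite
measure. -/
theorem exists_set_tendsto_zero {h : ℝ → ℝ} (hm : Measurable h) (h0 : ∀ t, 0 ≤ h t)
    (hi : IntegrableOn h (Set.Ioi 0)) :
    ∃ A : Set ℝ, MeasurableSet A ∧ A ⊆ Set.Ici 0 ∧ volume A < ∞ ∧
      ∀ t : ℕ → ℝ, (∀ k, t k ∈ Set.Ici 0 \ A) → Tendsto t atTop atTop →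
        Tendsto (fun k => h (t k)) atTop (𝓝 0) := by
  -- Each superlevel set has finite measure, so its tail beyond N has measure tending to 0. Taking
  -- N_j with tail measure below 2⁻ʲ makes the union over j of finite measure; a sequence avoiding
  -- it satisfies h ≤ 1/(j+1) once past N_j.
  set B : ℕ → ℕ → Set ℝ := fun j N => {t | 1 / ((j : ℝ) + 1) < h t} ∩ Set.Ioi (N : ℝ)
  have hBm : ∀ j N, MeasurableSet (B j N) := fun j N =>
    (measurableSet_lt measurable_const hm).inter measurableSet_Ioi
  have hfin : ∀ j, volume (B j 0) ≠ ∞ := by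
    intro j
    have h1 := hi.measure_gt_lt_top (ε := 1 / ((j : ℝ) + 1)) (by positivity)
    rw [Measure.restrict_apply (measurableSet_lt measurable_const hm)] at h1
    simpa [B] using h1.ne
  have hlim : ∀ j, Tendsto (fun N => volume (B j N)) atTop (𝓝 0) := by
    intro j
    have h1 := tendsto_measure_iInter_atTop (μ := volume) (s := B j)
      (fun N => (hBm j N).nullMeasurableSet)
      (fun N N' hN => Set.inter_subset_inter_right _ (Set.Ioi_subset_Ioi (by exact_mod_cast hN)))
      ⟨0, hfin j⟩
    have h2 : ⋂ N, B j N = ∅ := by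
      rw [Set.eq_empty_iff_forall_notMem]
      intro t ht
      obtain ⟨N, hN⟩ := exists_nat_gt t
      have h3 : (N : ℝ) < t := (Set.mem_iInter.1 ht N).2
      linarith
    rw [h2, measure_empty] at h1
    exact h1
  have hN : ∀ j : ℕ, ∃ N, volume (B j N) < (1 / 2 : ℝ≥0∞) ^ j := fun j =>
    ((hlim j).eventually (gt_mem_nhds (ENNReal.pow_pos (by simp) j))).exists
  choose N hN using hN
  refine ⟨⋃ j, B j (N j), MeasurableSet.iUnion fun j => hBm j _, ?_, ?_, ?_⟩
  · refine Set.iUnion_subset fun j t ht => ?_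
    have : (N j : ℝ) < t := ht.2
    exact (Nat.cast_nonneg (N j)).trans this.le
  · refine (measure_iUnion_le _).trans_lt ?_
    refine (ENNReal.tsum_le_tsum fun j => (hN j).le).trans_lt ?_
    rw [ENNReal.tsum_geometric]
    simp
  · intro t ht htop
    rw [Metric.tendsto_atTop']
    intro ε hε
    obtain ⟨j, hj⟩ := exists_nat_one_div_lt hε
    obtain ⟨k₀, hk₀⟩ := eventually_atTop.1 (htop.eventually_gt_atTop (N j : ℝ))
    refine ⟨k₀, fun k hk => ?_⟩
    rw [dist_zero_right, Real.norm_of_nonneg (h0 _)]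
    have h1 : t k ∉ B j (N j) := fun h1 => (ht k).2 (Set.mem_iUnion.2 ⟨j, h1⟩)
    have h2 : ¬ 1 / ((j : ℝ) + 1) < h (t k) := fun h2 => h1 ⟨h2, hk₀ k hk.le⟩
    exact (not_lt.1 h2).trans_lt hj

end Exceptional

/-! ### Energy dissipation and the chain rule -/

section Dissipation

/-- A nonnegative energy that dissipates at rate `κ h` makes `h` integrable on `(0, ∞)`. -/
theorem integrableOn_of_dissipation {E E' h : ℝ → ℝ} (hh : Continuous h) (h0 : ∀ t, 0 ≤ h t)
    (hE0 : ∀ t, 0 ≤ E t) (hE : ∀ t, 0 ≤ t → HasDerivWithinAt E (E' t) (Set.Ici 0) t) {κ : ℝ}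
    (hκ : 0 < κ) (hle : ∀ t, 0 ≤ t → E' t ≤ -κ * h t) : IntegrableOn h (Set.Ioi 0) := by
  have hF : ∀ t, 0 ≤ t → HasDerivWithinAt (fun t => E t + κ * ∫ s in (0 : ℝ)..t, h s)
      (E' t + κ * h t) (Set.Ici 0) t := fun t ht =>
    (hE t ht).add (((hh.integral_hasStrictDerivAt 0 t).hasDerivAt.hasDerivWithinAt).const_mul κ)
  -- Comparison with time 0 then gives κ∫₀ᵗ h ≤ E(0) - E(t) ≤ E(0), uniformly in t.
  have hanti : AntitoneOn (fun t => E t + κ * ∫ s in (0 : ℝ)..t, h s) (Set.Ici 0) := by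
    refine antitoneOn_of_hasDerivWithinAt_nonpos (convex_Ici 0)
      (fun t ht => (hF t ht).continuousWithinAt)
      (fun t ht => (hF t (interior_subset ht)).mono interior_subset) fun t ht => ?_
    have := hle t (interior_subset ht)
    linarith
  refine integrableOn_Ioi_of_intervalIntegral_norm_bounded (E 0 / κ) 0 (l := atTop) (b := id)
    (fun t => (hh.integrableOn_Icc (a := 0) (b := t)).mono_set Set.Ioc_subset_Icc_self)
    tendsto_id ?_
  filter_upwards [eventually_ge_atTop 0] with t ht
  have h1 := hanti Set.self_mem_Ici ht ht
  simp only [intervalIntegral.integral_same, mul_zero, add_zero] at h1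
  have h2 : ∫ s in (0 : ℝ)..id t, ‖h s‖ = ∫ s in (0 : ℝ)..t, h s := by
    simp only [id, Real.norm_eq_abs, abs_of_nonneg (h0 _)]
  rw [h2, le_div_iff₀ hκ]
  linarith [hE0 t]

/-- The chain rule along a differentiable curve for a Lipschitz map with a directional
derivative. -/
theorem HasLineDerivAt.comp_hasDerivWithinAt {V W : Type*} [NormedAddCommGroup V]
    [NormedSpace ℝ V] [NormedAddCommGroup W] [NormedSpace ℝ W] {f : V → W} {K : ℝ}
    (hf : ∀ x y, ‖f x - f y‖ ≤ K * ‖x - y‖) {Q : ℝ → V} {q : V} {ℓ : W} {s : Set ℝ} {t : ℝ}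
    (hℓ : HasLineDerivAt ℝ f ℓ (Q t) q) (hQ : HasDerivWithinAt Q q s t) :
    HasDerivWithinAt (fun r => f (Q r)) ℓ s t := by
  have h1 : HasDerivAt (fun r => f (Q t + (r - t) • q)) ℓ t := by
    have h2 : HasDerivAt (fun r => f (Q t + r • q)) ℓ (t - t) := by
      rw [sub_self]; exact hℓ
    exact h2.comp_sub_const t t
  rw [hasDerivWithinAt_iff_isLittleO] at hQ ⊢
  have h3 := (hasDerivAt_iff_isLittleO.1 h1).mono (nhdsWithin_le_nhds (s := s))
  -- A directional derivative only sees straight lines; the Lipschitz bound makes replacing the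
  -- curve by its tangent line cost o(r - t).
  have h4 : (fun r => f (Q r) - f (Q t + (r - t) • q)) =o[𝓝[s] t] fun r => r - t := by
    refine Asymptotics.IsBigO.trans_isLittleO (Asymptotics.IsBigO.of_bound K
      (Eventually.of_forall fun r => ?_)) hQ
    refine (hf _ _).trans (le_of_eq ?_)
    congr 2
    abel
  refine (h4.add h3).congr_left fun r => ?_
  rw [sub_self, zero_smul, add_zero]
  abel

end Dissipation

/-! ### Lipschitz continuity and monotonicity of directional derivatives -/

section Main

variable {n : ℕ} {Ω : TopologicalSpace.Opens (Eucl n)} {D : Density Ω}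

theorem eLpNorm_fun_sum_le {X ι : Type*} [MeasurableSpace X] {μ : Measure X} [Fintype ι]
    {f : ι → X → ℝ} (hf : ∀ i, AEStronglyMeasurable (f i) μ) :
    eLpNorm (fun x => ∑ i, f i x) 2 μ ≤ ∑ i, eLpNorm (f i) 2 μ := by
  have h := eLpNorm_sum_le (s := Finset.univ) (f := f) (p := 2) (μ := μ) (fun i _ => hf i)
    (by norm_num)
  rwa [show (fun x => ∑ i, f i x) = ∑ i, f i by ext x; simp]

theorem eLpNorm_jetSize_le (F : H2 D) : eLpNorm (jetSize F) 2 D.measure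
    ≤ (1 + n + ‖(1 / 2 : ℝ)‖ₑ * (n * n)) * ‖F‖ₑ := by
  have hc : ∀ m : JetIndex n, eLpNorm (F.1 m) 2 D.measure ≤ ‖F‖ₑ := by
    intro m
    rw [← Lp.enorm_def]
    exact enorm_le_iff_norm_le.2 (PiLp.norm_apply_le F.1 m)
  have hc' : ∀ m : JetIndex n, eLpNorm (fun x => |F.1 m x|) 2 D.measure ≤ ‖F‖ₑ := fun m => by
    refine (le_of_eq ?_).trans (hc m)
    exact eLpNorm_norm (F.1 m)
  have hm : ∀ m : JetIndex n, AEStronglyMeasurable (fun x => |F.1 m x|) D.measure := fun m =>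
    (Lp.memLp (F.1 m)).abs.1
  have hs : ∀ i, AEStronglyMeasurable (fun x => ∑ j, |F.dd i j x|) D.measure := fun i =>
    Finset.aestronglyMeasurable_fun_sum _ fun j _ => hm (Sum.inr (Sum.inr (i, j)))
  have e1 : eLpNorm (fun x => ∑ i, |F.d i x|) 2 D.measure ≤ n * ‖F‖ₑ := by
    refine (eLpNorm_fun_sum_le fun i => hm (Sum.inr (Sum.inl i))).trans ?_
    refine (Finset.sum_le_sum fun i _ => hc' (Sum.inr (Sum.inl i))).trans ?_
    simp
  have e2 : eLpNorm (fun x => ∑ i, ∑ j, |F.dd i j x|) 2 D.measure ≤ (n * n) * ‖F‖ₑ := by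
    refine (eLpNorm_fun_sum_le fun i => hs i).trans ?_
    refine (Finset.sum_le_sum fun i _ => (eLpNorm_fun_sum_le
      fun j => hm (Sum.inr (Sum.inr (i, j)))).trans
        (Finset.sum_le_sum fun j _ => hc' (Sum.inr (Sum.inr (i, j))))).trans ?_
    simp [mul_assoc]
  have hs1 : AEStronglyMeasurable (fun x => ∑ i, |F.d i x|) D.measure :=
    Finset.aestronglyMeasurable_fun_sum _ fun i _ => hm (Sum.inr (Sum.inl i))
  have hs2 : AEStronglyMeasurable (fun x => ∑ i, ∑ j, |F.dd i j x|) D.measure :=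
    Finset.aestronglyMeasurable_fun_sum _ fun i _ => hs i
  refine (eLpNorm_add_le ((hm (Sum.inl ())).add hs1) (hs2.const_mul _) (by norm_num)).trans ?_
  rw [add_mul, add_mul, one_mul, mul_assoc]
  refine add_le_add ((eLpNorm_add_le (hm (Sum.inl ())) hs1 (by norm_num)).trans
    (add_le_add (hc' (Sum.inl ())) e1)) ?_
  refine (le_of_eq (eLpNorm_const_smul (1 / 2 : ℝ) _ 2 D.measure)).trans ?_
  exact mul_le_mul_right e2 _

/-- Needed for the chain rule along Q: Gateaux differentiability alone does not give one. -/
theorem PointwiseLipschitz.exists_lipschitz {L : H2 D → D.L2} (hL : PointwiseLipschitz L) :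
    ∃ K : ℝ, ∀ F G : H2 D, ‖L F - L G‖ ≤ K * ‖F - G‖ := by
  obtain ⟨C, hC0, hC⟩ := hL.exists_bound
  set N : ℝ≥0∞ := 1 + n + ‖(1 / 2 : ℝ)‖ₑ * (n * n)
  have hN : N ≠ ∞ := by simp [N, ENNReal.mul_eq_top]
  refine ⟨C * N.toReal, fun F G => ?_⟩
  have h1 : ‖L F - L G‖ ≤ C * ‖(memLp_jetSize (F - G)).toLp _‖ := by
    refine Lp.norm_le_mul_norm_of_ae_le_mul ?_
    filter_upwards [hC F G, Lp.coeFn_sub (L F) (L G), (memLp_jetSize (F - G)).coeFn_toLp]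
      with x h2 h3 h4
    rw [h3, h4, Pi.sub_apply]
    exact h2.trans (mul_le_mul_of_nonneg_left (le_abs_self _) hC0)
  refine h1.trans ?_
  rw [mul_assoc, Lp.norm_toLp]
  refine mul_le_mul_of_nonneg_left ?_ hC0
  have h5 := ENNReal.toReal_mono (ENNReal.mul_ne_top hN enorm_ne_top)
    (eLpNorm_jetSize_le (F - G))
  rw [ENNReal.toReal_mul, toReal_enorm] at h5
  exact h5

/-- The infinitesimal form of `inner_le_of_abs_le`: take the increment s•q, divide by s² and let s
decrease to 0. -/
theorem inner_le_of_hasLineDerivAt (hΩ : Bornology.IsBounded (Ω : Set (Eucl n)))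
    {η : Eucl n → ℝ} (hη : IsAuxiliary (Ω : Set (Eucl n)) η) {L : H2 D → D.L2}
    (hL : PointwiseLipschitz L) {γ : ℝ}
    (hmono : ∀ f₁ f₂ : H2 D, ZeroTrace f₁ → ZeroTrace f₂ →
      ⟪f₁.fn - f₂.fn, L f₁ - L f₂⟫_ℝ ≤ -γ * ‖f₁.fn - f₂.fn‖ ^ 2)
    {g q : H2 D} {K : ℝ} (hK : ∀ᵐ x ∂D.measure, |q.fn x| ≤ K * η x) {ℓ : D.L2}
    (hℓ : HasLineDerivAt ℝ L ℓ g q) : ⟪q.fn, ℓ⟫_ℝ ≤ -γ * ‖q.fn‖ ^ 2 := by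
  have h0 : HasDerivAt (fun s : ℝ => L (g + s • q)) ℓ 0 := hℓ
  have h1 := (tendsto_const_nhds (x := q.fn)).inner (𝕜 := ℝ) h0.tendsto_slope_zero_right
  refine le_of_tendsto h1 ?_
  filter_upwards [self_mem_nhdsWithin] with s hs
  have hs0 : (0 : ℝ) < s := hs
  have hfn : (s • q).fn = s • q.fn := rfl
  have h2 := inner_le_of_abs_le hΩ hη hL hmono g (s • q) (K := s * K) (by
    filter_upwards [hK, Lp.coeFn_smul s q.fn] with x hx hx2
    rw [hfn, hx2, Pi.smul_apply, smul_eq_mul, abs_mul, abs_of_pos hs0, mul_assoc]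
    exact mul_le_mul_of_nonneg_left hx hs0.le)
  rw [hfn, real_inner_smul_left, norm_smul, Real.norm_of_nonneg hs0.le] at h2
  rw [zero_add, zero_smul, add_zero, real_inner_smul_right, inv_mul_le_iff₀ hs0]
  refine le_of_mul_le_mul_left (h2.trans (le_of_eq ?_)) hs0
  ring

end Main

theorem eLpNorm_integralOp {n : ℕ} {Ω : TopologicalSpace.Opens (Eucl n)} {D : Density Ω}
    {B : Eucl n → Eucl n → ℝ} {T : D.L2 →L[ℝ] D.L2}
    (hT : ∀ v, T v =ᵐ[D.measure] integralOp D B v) (v : D.L2) :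
    eLpNorm (integralOp D B v) 2 D.measure = ENNReal.ofReal ‖T v‖ := by
  rw [← eLpNorm_congr_ae (hT v), ← Lp.enorm_def, ofReal_norm]

/-- Along the wide network limit, `‖𝓑𝓛Q‖²` is integrable in time. -/
theorem IsWideNetworkLimit.integrableOn {n : ℕ} {Ω : TopologicalSpace.Opens (Eucl n)}
    (hΩ : Bornology.IsBounded (Ω : Set (Eucl n))) {D : Density Ω} {L : H2 D → D.L2}
    (hlip : PointwiseLipschitz L) (hmono : StronglyMonotone L) (hgat : GateauxDifferentiable L)
    {f : H2 D} {η : Eucl n → ℝ} (hη : IsAuxiliary (Ω : Set (Eucl n)) η)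
    {B : Eucl n → Eucl n → ℝ} {T : D.L2 →L[ℝ] D.L2}
    (hT : ∀ v, T v =ᵐ[D.measure] integralOp D B v)
    (hsymm : ∀ u v, ⟪T u, v⟫_ℝ = ⟪u, T v⟫_ℝ) (hpos : ∀ v, 0 ≤ ⟪T v, v⟫_ℝ)
    (hη' : ∀ v, ∃ K : ℝ, ∀ᵐ x ∂D.measure, |T v x| ≤ K * η x)
    {α : ℝ} (hα : 0 < α) {Q : ℝ → H2 D} (hQ : IsWideNetworkLimit α B L η f Q) :
    Continuous (fun t => ‖T (L (Q (max t 0)))‖ ^ 2) ∧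
      IntegrableOn (fun t => ‖T (L (Q (max t 0)))‖ ^ 2) (Set.Ioi 0) := by
  obtain ⟨γ, hγ, hmono⟩ := hmono
  obtain ⟨K, hK⟩ := hlip.exists_lipschitz
  choose! q hq hqT using hQ.2
  have hqfn : ∀ t, 0 ≤ t → (q t).fn = α • T (L (Q t)) := by
    intro t ht
    refine Lp.ext ?_
    filter_upwards [hqT t ht, Lp.coeFn_smul α (T (L (Q t))), hT (L (Q t))] with x h1 h2 h3
    rw [h1, h2, Pi.smul_apply, h3, smul_eq_mul]
  set ℓ : ℝ → D.L2 := fun t => lineDeriv ℝ L (Q t) (q t)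
  have hℓ : ∀ t, HasLineDerivAt ℝ L (ℓ t) (Q t) (q t) := fun t =>
    (hgat (Q t) (q t)).hasLineDerivAt
  have hd : ∀ t, 0 ≤ t → HasDerivWithinAt (fun r => L (Q r)) (ℓ t) (Set.Ici 0) t := fun t ht =>
    HasLineDerivAt.comp_hasDerivWithinAt hK (hℓ t) (hq t ht)
  -- Symmetry of T merges the two terms of the product rule.
  have hE : ∀ t, 0 ≤ t → HasDerivWithinAt (fun r => ⟪T (L (Q r)), L (Q r)⟫_ℝ)
      (2 * ⟪T (L (Q t)), ℓ t⟫_ℝ) (Set.Ici 0) t := by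
    intro t ht
    have h1 := (T.hasFDerivAt.comp_hasDerivWithinAt t (hd t ht)).inner ℝ (hd t ht)
    refine h1.congr_deriv ?_
    change ⟪T (L (Q t)), ℓ t⟫_ℝ + ⟪T (ℓ t), L (Q t)⟫_ℝ = _
    rw [hsymm (ℓ t), real_inner_comm (T (L (Q t))) (ℓ t), two_mul]
  have hle : ∀ t, 0 ≤ t → 2 * ⟪T (L (Q t)), ℓ t⟫_ℝ
      ≤ -(2 * γ * α) * ‖T (L (Q (max t 0)))‖ ^ 2 := by
    intro t ht
    obtain ⟨M, hM⟩ := hη' (L (Q t))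
    have h1 := inner_le_of_hasLineDerivAt hΩ hη hlip hmono (K := α * M) (by
      filter_upwards [hM, Lp.coeFn_smul α (T (L (Q t)))] with x hx hx2
      rw [hqfn t ht, hx2, Pi.smul_apply, smul_eq_mul, abs_mul, abs_of_pos hα, mul_assoc]
      exact mul_le_mul_of_nonneg_left hx hα.le) (hℓ t)
    rw [hqfn t ht, real_inner_smul_left, norm_smul, Real.norm_of_nonneg hα.le] at h1
    rw [max_eq_left ht]
    -- Substituting q = αT𝓛Q puts one α on the left and α² on the right; cancelling one leaves the
    -- dissipation rate 2γα.
    have h2 : α * ⟪T (L (Q t)), ℓ t⟫_ℝ ≤ α * (-γ * α * ‖T (L (Q t))‖ ^ 2) :=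
      h1.trans (le_of_eq (by ring))
    have h3 := le_of_mul_le_mul_left h2 hα
    linarith
  -- The curve is controlled only for t ≥ 0; freezing it at time 0 before that gives continuity on
  -- all of ℝ.
  have hcont : Continuous fun t : ℝ => L (Q (max t 0)) := by
    have h1 : ContinuousOn (fun r => L (Q r)) (Set.Ici 0) := fun t ht =>
      (hd t ht).continuousWithinAt
    exact h1.comp_continuous (continuous_id.max continuous_const) fun t => Set.mem_Ici.2 (le_max_right _ _)
  have hc : Continuous fun t => ‖T (L (Q (max t 0)))‖ ^ 2 := (T.continuous.comp hcont).norm.pow 2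
  exact ⟨hc, integrableOn_of_dissipation hc (fun t => by positivity) (fun t => hpos _) hE
    (by positivity) hle⟩

end QPDE

end

theorem mainTheorem8 {n : ℕ} (Ω : TopologicalSpace.Opens (QPDE.Eucl n))
    (hΩ_bdd : Bornology.IsBounded (Ω : Set (QPDE.Eucl n)))
    (hΩ_reg : ∃ a : ℝ≥0, 0 < a ∧ a < 1 ∧ QPDE.HasC3HolderBoundary (Ω : Set (QPDE.Eucl n)) a)
    (D : QPDE.Density Ω)
    (L : QPDE.H2 D → D.L2)
    (hL_lip : QPDE.PointwiseLipschitz L)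
    (hL_mono : QPDE.StronglyMonotone L)
    (hL_gateaux : QPDE.GateauxDifferentiable L)
    (f : QPDE.H2 D)
    (h_sol : ∃ u : QPDE.H2 D, QPDE.IsSolution L f u)
    (η : QPDE.Eucl n → ℝ) (hη : QPDE.IsAuxiliary (Ω : Set (QPDE.Eucl n)) η)
    (σ : ℝ → ℝ) (hσ : QPDE.IsActivation σ)
    {S : Type*} [MeasurableSpace S] (P : Measure S) [IsProbabilityMeasure P]
    (c : S → ℝ) (w : S → QPDE.Eucl n) (b : S → ℝ) (h_init : QPDE.IsInitialization P c w b)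
    (α : ℝ) (hα : 0 < α)
    (Q : ℝ → QPDE.H2 D)
    (hQ : QPDE.IsWideNetworkLimit α (QPDE.limitKernel P c w b σ η) L η f Q) :
    (∃ A : Set ℝ, MeasurableSet A ∧
      QPDE.IsExceptionalSet (QPDE.limitKernel P c w b σ η) L Q A) ∧
    ∀ A : Set ℝ, QPDE.IsExceptionalSet (QPDE.limitKernel P c w b σ η) L Q A →
      ∀ t : ℕ → ℝ, (∀ k, t k ∈ Set.Ici 0 \ A) → Tendsto t atTop atTop →
        (Tendsto (fun k => toWeakSpace ℝ D.L2 (L (Q (t k)))) atTop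
            (𝓝 (toWeakSpace ℝ D.L2 0)) ↔
          ∃ C : ℝ, ∀ k, ‖L (Q (t k))‖ ≤ C) := by
  obtain ⟨T, hT, hsymm, hpos, hinj, hTη⟩ :=
    QPDE.exists_limitOperator (D := D) hΩ_bdd hη hσ h_init
  obtain ⟨hcont, hint⟩ :=
    hQ.integrableOn hΩ_bdd hL_lip hL_mono hL_gateaux hη hT hsymm hpos hTη hα
  refine ⟨?_, fun A hA t ht htop => ?_⟩
  · obtain ⟨A, hAm, hA0, hAfin, hA⟩ :=
      QPDE.exists_set_tendsto_zero hcont.measurable (fun _ => by positivity) hint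
    refine ⟨A, hAm, hA0, hAfin, fun t ht htop => ?_⟩
    have h1 := (hA t ht htop).sqrt
    simp only [QPDE.eLpNorm_integralOp hT]
    rw [← ENNReal.ofReal_zero]
    refine ENNReal.tendsto_ofReal ?_
    rw [Real.sqrt_zero] at h1
    refine h1.congr fun k => ?_
    have : (0 : ℝ) ≤ t k := (ht k).1
    rw [Real.sqrt_sq (norm_nonneg _), max_eq_left this]
  · rw [QPDE.tendsto_toWeakSpace_zero_iff]
    -- Weak convergence implies boundedness for any sequence; only the converse uses that the times
    -- avoid A.
    refine ⟨QPDE.exists_bound_of_forall_tendsto_inner, fun ⟨C, hC⟩ => ?_⟩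
    refine QPDE.tendsto_inner_of_bounded hsymm hinj hC ?_
    rw [tendsto_zero_iff_norm_tendsto_zero]
    have h1 := hA.2.2 t ht htop
    simp only [QPDE.eLpNorm_integralOp hT] at h1
    have h2 := (ENNReal.tendsto_toReal ENNReal.zero_ne_top).comp h1
    simpa [Function.comp_def] using h2
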